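/- Let $F$ be the 2-sphere minus four open disks, with $\pi=\pi_1(F)=\langle a,b,c,d\mid abcd=1\rangle$, where $a,b,c,d$ are the meridians (boundary loops). Identify $SU(2)$ with the unit quaternions, with Lie algebra $su(2)$ the imaginary quaternions and $\{v,w\}=-\tfrac12\mathrm{Tr}(vw)=-\mathrm{Re}(vw)$. Let $\chi(S^2,4)$ be the space (with the quotient topology) of conjugacy classes of homomorphisms $\rho:\pi\to SU(2)$ that send $a,b,c,d$ to traceless elements (unit quaternions with zero real part). The formal tangent space at $[\rho]$ is $\widehat H^1(F;su(2)_{\mathrm{ad}\rho})=\ker\big(H^1(F;su(2)_{\mathrm{ad}\rho})\to H^1(\partial F;su(2)_{\mathrm{ad}\rho})\big)=\mathrm{im}\big(H^1(F,\partial F;su(2)_{\mathrm{ad}\rho})\to H^1(F;su(2)_{\mathrm{ad}\rho})\big)$; on it the Atiyah–Bott–Goldman form $\widehat\omega$ is induced by the cup product on $H^1(F,\partial F)$, with coefficients paired by $\{\ ,\ \}$, evaluated on the fundamental class of $(F,\partial F)$. Let $\chi(S^2,4)^*$ be the set of regular points: those with a neighborhood on which $\dim\widehat H^1$ is constant. Let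 $\mathbb T=U(1)\times U(1)$, let $\iota(e^{ix},e^{iy})=(e^{-ix},e^{-iy})$, let $\mathbb T^*$ be the complement of the four fixed points of $\iota$, and let $\mathbb P=\mathbb T/\iota$, $\mathbb P^*=\mathbb T^*/\iota$. The group $PSL(2,\mathbb Z)=SL(2,\mathbb Z)/\{\pm1\}$ acts on $\mathbb P$ by $\begin{pmatrix}p&r\\q&s\end{pmatrix}\cdot[e^{ix},e^{iy}]=[e^{i(px+ry)},e^{i(qx+sy)}]$. Define $\hat\rho:\mathbb P\to\chi(S^2,4)$ by $\hat\rho([e^{ix},e^{iy}])=[a\mapsto j,\ b\mapsto e^{ix}j,\ c\mapsto e^{iy}j]$. Let $H_1,H_2$ be the automorphisms of $\pi$ induced by the half Dehn twists in two twice-punctured disks, one containing the punctures $c,d$ and the other containing the punctures $b,d$, namely $$H_1:\ a\mapsto a,\quad b\mapsto b,\quad c\mapsto d=c^{-1}b^{-1}a^{-1};\qquad H_2:\ a\mapsto a,\quad b\mapsto cdc^{-1}=b^{-1}a^{-1}c^{-1},\quad c\mapsto c,$$ and let $H_i^*:[\rho]\mapsto[\rho\circ H_i]$ be the induced homeomorphisms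 of $\chi(S^2,4)$. Theorem. The subgroup of $\mathrm{Homeo}(\chi(S^2,4))$ generated by $H_1^*$ and $H_2^*$ is the image of a faithful action of $PSL(2,\mathbb Z)$ on $\chi(S^2,4)$. This action maps $\chi(S^2,4)^*$ to itself by diffeomorphisms and preserves $\widehat\omega$. The map $\hat\rho$ is a $PSL(2,\mathbb Z)$-equivariant homeomorphism from $\mathbb P$ onto $\chi(S^2,4)$, and for some nonzero constant $c$ it restricts to a $PSL(2,\mathbb Z)$-equivariant symplectomorphism from $(\mathbb P^*,c\,dx\wedge dy)$ onto $(\chi(S^2,4)^*,\widehat\omega)$. -/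

import Mathlib

open scoped Quaternion ContDiff Topology MatrixGroups

noncomputable section

namespace FourPunctured

/-! ## The fundamental group of the four-punctured sphere and the half Dehn twists -/

/-- The single relator `a b c d` in the free group on four letters. -/
def relators : Set (FreeGroup (Fin 4)) :=
  {FreeGroup.of 0 * FreeGroup.of 1 * FreeGroup.of 2 * FreeGroup.of 3}

/-- The fundamental group of the sphere minus four open disks,
`⟨a, b, c, d ∣ a b c d = 1⟩`, where `a, b, c, d` are the four boundary loops (meridians). -/
abbrev SurfaceGroup : Type := PresentedGroup relators

/-- The four meridians `a, b, c, d`, numbered `0, 1, 2, 3`. -/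
def mer (i : Fin 4) : SurfaceGroup := PresentedGroup.of i

theorem mer_rel : mer 0 * mer 1 * mer 2 * mer 3 = 1 := by
  have h : PresentedGroup.mk relators
      (FreeGroup.of 0 * FreeGroup.of 1 * FreeGroup.of 2 * FreeGroup.of 3) = 1 :=
    PresentedGroup.one_of_mem (Set.mem_singleton _)
  simp only [map_mul] at h
  exact h

/-- The homomorphism out of the surface group with prescribed values on the meridians. -/
def homOfMer {G : Type*} [Group G] (w x y z : G) (h : w * x * y * z = 1) : SurfaceGroup →* G :=
  PresentedGroup.toGroup (f := ![w, x, y, z]) (by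
    intro r hr
    rw [relators, Set.mem_singleton_iff] at hr
    subst hr
    simpa using h)

theorem homOfMer_mer {G : Type*} [Group G] (w x y z : G) (h : w * x * y * z = 1) (i : Fin 4) :
    homOfMer w x y z h (mer i) = ![w, x, y, z] i :=
  PresentedGroup.toGroup.of _

theorem hom_ext_mer {G : Type*} [Group G] {φ ψ : SurfaceGroup →* G}
    (h : ∀ i, φ (mer i) = ψ (mer i)) : φ = ψ :=
  PresentedGroup.ext h

theorem mer_three : mer 3 = (mer 2)⁻¹ * (mer 1)⁻¹ * (mer 0)⁻¹ := by
  have h := eq_inv_of_mul_eq_one_right mer_rel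
  rw [h]; group

theorem twist₁_rel : mer 0 * mer 1 * mer 3 * ((mer 3)⁻¹ * mer 2 * mer 3) = 1 := by
  have h := mer_rel
  calc _ = mer 0 * mer 1 * mer 2 * mer 3 := by group
    _ = 1 := h

theorem twist₁_inv_rel : mer 0 * mer 1 * (mer 2 * mer 3 * (mer 2)⁻¹) * mer 2 = 1 := by
  have h := mer_rel
  calc _ = mer 0 * mer 1 * mer 2 * mer 3 := by group
    _ = 1 := h

theorem twist₂_rel :
    mer 0 * (mer 2 * mer 3 * (mer 2)⁻¹) * mer 2 * (mer 0 * mer 1 * (mer 0)⁻¹) = 1 := by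
  simp only [mer_three]
  group

theorem twist₂_inv_rel :
    mer 0 * ((mer 0)⁻¹ * mer 3 * mer 0) * mer 2 * ((mer 2)⁻¹ * mer 1 * mer 2) = 1 := by
  simp only [mer_three]
  group

/-- The automorphism of the fundamental group induced by the half Dehn twist in the disk `H₁`,
which contains the punctures `c` and `d` and is bounded by the loop `c d`
(the base point and the loops `a`, `b` lie outside the disk):
`a ↦ a`, `b ↦ b`, `c ↦ d = c⁻¹ b⁻¹ a⁻¹`, and hence `d ↦ d⁻¹ c d`. -/
def halfTwist₁ : MulAut SurfaceGroup :=
  MonoidHom.toMulEquiv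
    (homOfMer (mer 0) (mer 1) (mer 3) ((mer 3)⁻¹ * mer 2 * mer 3) twist₁_rel)
    (homOfMer (mer 0) (mer 1) (mer 2 * mer 3 * (mer 2)⁻¹) (mer 2) twist₁_inv_rel)
    (by
      apply hom_ext_mer
      intro i
      fin_cases i <;> simp [homOfMer_mer, mul_assoc])
    (by
      apply hom_ext_mer
      intro i
      fin_cases i <;> simp [homOfMer_mer, mul_assoc])

/-- The automorphism of the fundamental group induced by the half Dehn twist in the disk `H₂`,
which contains the punctures `b` and `d` and is bounded by the loop `b b'`, where
`b' = c d c⁻¹ = b⁻¹ a⁻¹ c⁻¹` is a meridian of the puncture `d`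
(the base point and the loops `a`, `c` lie outside the disk):
`a ↦ a`, `b ↦ b'`, `c ↦ c`, and hence `d ↦ a b a⁻¹` and `b' ↦ b'⁻¹ b b'`. -/
def halfTwist₂ : MulAut SurfaceGroup :=
  MonoidHom.toMulEquiv
    (homOfMer (mer 0) (mer 2 * mer 3 * (mer 2)⁻¹) (mer 2) (mer 0 * mer 1 * (mer 0)⁻¹) twist₂_rel)
    (homOfMer (mer 0) ((mer 0)⁻¹ * mer 3 * mer 0) (mer 2) ((mer 2)⁻¹ * mer 1 * mer 2) twist₂_inv_rel)
    (by
      apply hom_ext_mer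
      intro i
      fin_cases i <;> simp [homOfMer_mer, mul_assoc])
    (by
      apply hom_ext_mer
      intro i
      fin_cases i <;> simp [homOfMer_mer, mul_assoc])

theorem halfTwist₁_mer (i : Fin 4) :
    halfTwist₁ (mer i) = (![mer 0, mer 1, (mer 2)⁻¹ * (mer 1)⁻¹ * (mer 0)⁻¹,
      (mer 3)⁻¹ * mer 2 * mer 3] : Fin 4 → SurfaceGroup) i := by
  rw [← mer_three]
  exact homOfMer_mer _ _ _ _ twist₁_rel i

theorem halfTwist₂_mer (i : Fin 4) :
    halfTwist₂ (mer i) = (![mer 0, (mer 1)⁻¹ * (mer 0)⁻¹ * (mer 2)⁻¹, mer 2,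
      mer 0 * mer 1 * (mer 0)⁻¹] : Fin 4 → SurfaceGroup) i := by
  have h : (mer 1)⁻¹ * (mer 0)⁻¹ * (mer 2)⁻¹ = mer 2 * mer 3 * (mer 2)⁻¹ := by
    rw [mer_three]; group
  rw [h]
  exact homOfMer_mer _ _ _ _ twist₂_rel i

/-! ## The traceless character variety -/

/-- `SU(2)`, as the group of unit quaternions; half the trace is the real part. -/
abbrev SU2 : Type := ↥(unitary ℍ[ℝ])

/-- Homomorphisms from the surface group to `SU(2)` that send all four meridians to the
conjugacy class of traceless elements (unit quaternions with zero real part). -/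
def RepSpace : Type :=
  {ρ : SurfaceGroup →* SU2 // ∀ i, ((ρ (mer i) : SU2) : ℍ[ℝ]).re = 0}

/-- The topology of pointwise convergence; it is the subspace topology of `SU(2)⁴` under
evaluation at the meridians. -/
instance : TopologicalSpace RepSpace :=
  TopologicalSpace.induced (fun ρ (g : SurfaceGroup) => ρ.1 g) inferInstance

/-- Conjugation of representations. -/
instance repSetoid : Setoid RepSpace where
  r ρ σ := ∃ g : SU2, ∀ x, σ.1 x = g * ρ.1 x * g⁻¹
  iseqv :=
    { refl := fun ρ => ⟨1, by simp⟩
      symm := by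
        rintro ρ σ ⟨g, hg⟩
        refine ⟨g⁻¹, fun x => ?_⟩
        rw [hg]; group
      trans := by
        rintro ρ σ τ ⟨g, hg⟩ ⟨h, hh⟩
        refine ⟨h * g, fun x => ?_⟩
        rw [hh, hg]; group }

/-- The traceless `SU(2)` character variety `χ(S², 4)`, with the quotient topology. -/
abbrev CharVar : Type := Quotient repSetoid

/-- The conjugacy class of a representation. -/
def cls (ρ : RepSpace) : CharVar := Quotient.mk repSetoid ρ

/-! ## Parabolic cohomology and the Atiyah–Bott–Goldman form -/

/-- The Lie algebra `su(2)`, as the space of purely imaginary quaternions. -/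
def su2 : Submodule ℝ ℍ[ℝ] where
  carrier := {v | v.re = 0}
  add_mem' := by
    intro v w hv hw
    simp only [Set.mem_ofPred_eq] at *
    simp [hv, hw]
  zero_mem' := by simp
  smul_mem' := by
    intro r v hv
    simp only [Set.mem_ofPred_eq] at *
    simp [hv]

/-- The adjoint action `v ↦ g v g⁻¹` (recall `g⁻¹ = star g` for a unit quaternion). -/
def Ad (g : SU2) : ℍ[ℝ] →ₗ[ℝ] ℍ[ℝ] where
  toFun v := (g : ℍ[ℝ]) * v * star (g : ℍ[ℝ])
  map_add' v w := by rw [mul_add, add_mul]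
  map_smul' r v := by simp

/-- The bilinear form `{v, w} = -½ Tr (v w) = -Re (v w)`. -/
def killing (v w : ℍ[ℝ]) : ℝ := -(v * w).re

/-- `1`-cocycles of the surface group with coefficients in `su(2)` twisted by `Ad ρ`. -/
def Cocycle (ρ : RepSpace) : Submodule ℝ (SurfaceGroup → ℍ[ℝ]) where
  carrier := {z | (∀ g, z g ∈ su2) ∧ ∀ g h, z (g * h) = z g + Ad (ρ.1 g) (z h)}
  add_mem' := by
    rintro z w ⟨hz, hz'⟩ ⟨hw, hw'⟩
    refine ⟨fun g => su2.add_mem (hz g) (hw g), fun g h => ?_⟩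
    simp only [Pi.add_apply, hz', hw', map_add]
    abel
  zero_mem' := ⟨fun _ => su2.zero_mem, fun _ _ => by simp⟩
  smul_mem' := by
    rintro r z ⟨hz, hz'⟩
    refine ⟨fun g => su2.smul_mem r (hz g), fun g h => ?_⟩
    simp only [Pi.smul_apply, hz', map_smul, smul_add]

/-- `1`-coboundaries `g ↦ g · ξ - ξ`. -/
def Coboundary (ρ : RepSpace) : Submodule ℝ (SurfaceGroup → ℍ[ℝ]) where
  carrier := {z | ∃ ξ ∈ su2, ∀ g, z g = Ad (ρ.1 g) ξ - ξ}
  add_mem' := by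
    rintro z w ⟨ξ, hξ, hz⟩ ⟨η, hη, hw⟩
    refine ⟨ξ + η, su2.add_mem hξ hη, fun g => ?_⟩
    simp only [Pi.add_apply, hz, hw, map_add]
    abel
  zero_mem' := ⟨0, su2.zero_mem, fun _ => by simp⟩
  smul_mem' := by
    rintro r z ⟨ξ, hξ, hz⟩
    refine ⟨r • ξ, su2.smul_mem r hξ, fun g => ?_⟩
    simp only [Pi.smul_apply, hz, map_smul, smul_sub]

/-- The elements `ξ = (ξ₀, …, ξ₃)`, one in `su(2)` for each boundary circle, whose coboundaries
are the restrictions of the cochain `z` to the boundary circles. For a cocycle `z` these are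
exactly the `ξ` for which `(z, ξ)` is a relative `1`-cocycle of the surface modulo its boundary
(in the mapping cone of the restriction of cochains to the boundary). -/
def IsRelLift (ρ : RepSpace) (z : SurfaceGroup → ℍ[ℝ]) (ξ : Fin 4 → ℍ[ℝ]) : Prop :=
  ∀ i, ξ i ∈ su2 ∧ z (mer i) = Ad (ρ.1 (mer i)) (ξ i) - ξ i

/-- Parabolic cocycles: those that become coboundaries on every boundary circle. -/
def ParCocycle (ρ : RepSpace) : Submodule ℝ (SurfaceGroup → ℍ[ℝ]) where
  carrier := {z | z ∈ Cocycle ρ ∧ ∃ ξ, IsRelLift ρ z ξ}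
  add_mem' := by
    rintro z w ⟨hz, ξ, hξ⟩ ⟨hw, η, hη⟩
    refine ⟨add_mem hz hw, ξ + η, fun i => ⟨su2.add_mem (hξ i).1 (hη i).1, ?_⟩⟩
    simp only [Pi.add_apply, (hξ i).2, (hη i).2, map_add]
    abel
  zero_mem' := ⟨zero_mem _, 0, fun _ => ⟨su2.zero_mem, by simp⟩⟩
  smul_mem' := by
    rintro r z ⟨hz, ξ, hξ⟩
    refine ⟨Submodule.smul_mem _ r hz, r • ξ, fun i => ⟨su2.smul_mem r (hξ i).1, ?_⟩⟩
    simp only [Pi.smul_apply, (hξ i).2, map_smul, smul_sub]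

/-- `Ĥ¹(F; su(2)_{Ad ρ})`, the kernel of `H¹(F) → H¹(∂F)`, equivalently the image of
`H¹(F, ∂F) → H¹(F)`: the formal tangent space of the character variety at the class of `ρ`. -/
abbrev Hhat (ρ : RepSpace) : Type :=
  ↥(ParCocycle ρ) ⧸ (Coboundary ρ).comap (ParCocycle ρ).subtype

/-- The bar `2`-chain `[a|b] + [ab|c] + [abc|d] + [1|1]`. Its boundary is
`[a] + [b] + [c] + [d]`, so it represents the fundamental class of the surface relative to its
boundary circles. -/
def fundChain : List (SurfaceGroup × SurfaceGroup) :=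
  [(mer 0, mer 1), (mer 0 * mer 1, mer 2), (mer 0 * mer 1 * mer 2, mer 3), (1, 1)]

/-- With `∂[g|h] = [h] - [gh] + [g]`, the boundary of `fundChain` is the sum of the four
meridians. -/
theorem fundChain_boundary {A : Type*} [AddCommGroup A] (f : SurfaceGroup → A) :
    (fundChain.map fun p => f p.2 - f (p.1 * p.2) + f p.1).sum = ∑ i, f (mer i) := by
  simp only [fundChain, List.map_cons, List.map_nil, List.sum_cons, List.sum_nil,
    Fin.sum_univ_four, mer_rel, mul_one]
  abel

/-- The cohomology intersection pairing `H¹(F, ∂F) × H¹(F) → ℝ` on the level of cocycles: the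
cup product `(z, ξ) ∪ w = (z ∪ w, ξ ∪ w)`, with coefficients paired by `{ , }`, where
`(z ∪ w)(g, h) = {z g, g · w h}` and `(ξ ∪ w)(g) = {ξ, w g}`, evaluated on the relative
fundamental class. -/
def relPairing (ρ : RepSpace) (z : SurfaceGroup → ℍ[ℝ]) (ξ : Fin 4 → ℍ[ℝ])
    (w : SurfaceGroup → ℍ[ℝ]) : ℝ :=
  (fundChain.map fun p => killing (z p.1) (Ad (ρ.1 p.1) (w p.2))).sum
    - ∑ i, killing (ξ i) (w (mer i))

theorem killing_add_left (u v w : ℍ[ℝ]) : killing (u + v) w = killing u w + killing v w := by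
  simp only [killing, add_mul, Quaternion.re_add]; ring

theorem killing_add_right (u v w : ℍ[ℝ]) : killing u (v + w) = killing u v + killing u w := by
  simp only [killing, mul_add, Quaternion.re_add]; ring

theorem killing_sub_left (u v w : ℍ[ℝ]) : killing (u - v) w = killing u w - killing v w := by
  simp only [killing, sub_mul, Quaternion.re_sub]; ring

theorem killing_sub_right (u v w : ℍ[ℝ]) : killing u (v - w) = killing u v - killing u w := by
  simp only [killing, mul_sub, Quaternion.re_sub]; ring

theorem killing_smul_left (r : ℝ) (v w : ℍ[ℝ]) : killing (r • v) w = r * killing v w := by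
  simp [killing]; ring

theorem killing_smul_right (r : ℝ) (v w : ℍ[ℝ]) : killing v (r • w) = r * killing v w := by
  simp [killing]; ring

theorem re_mul_comm (v w : ℍ[ℝ]) : (v * w).re = (w * v).re := by
  simp only [Quaternion.re_mul]; ring

theorem killing_Ad (g : SU2) (v w : ℍ[ℝ]) : killing (Ad g v) (Ad g w) = killing v w := by
  have hg : star (g : ℍ[ℝ]) * (g : ℍ[ℝ]) = 1 := Unitary.coe_star_mul_self g
  simp only [killing, Ad, LinearMap.coe_mk, AddHom.coe_mk]
  have h : (g : ℍ[ℝ]) * v * star (g : ℍ[ℝ]) * ((g : ℍ[ℝ]) * w * star (g : ℍ[ℝ]))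
      = (g : ℍ[ℝ]) * (v * w * star (g : ℍ[ℝ])) := by
    calc _ = (g : ℍ[ℝ]) * v * (star (g : ℍ[ℝ]) * (g : ℍ[ℝ])) * w * star (g : ℍ[ℝ]) := by
          simp only [mul_assoc]
      _ = _ := by rw [hg, mul_one]; simp only [mul_assoc]
  rw [h, re_mul_comm, mul_assoc, hg, mul_one]

theorem Ad_mul (g h : SU2) (v : ℍ[ℝ]) : Ad (g * h) v = Ad g (Ad h v) := by
  simp only [Ad, LinearMap.coe_mk, AddHom.coe_mk, Submonoid.coe_mul, star_mul, mul_assoc]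

/-- The pairing depends only on `z`, not on the choice of `ξ`, when `w` is parabolic. -/
theorem relPairing_lift_indep (ρ : RepSpace) {z w : SurfaceGroup → ℍ[ℝ]}
    {ξ ξ' : Fin 4 → ℍ[ℝ]} (h : IsRelLift ρ z ξ) (h' : IsRelLift ρ z ξ')
    (hw : w ∈ ParCocycle ρ) : relPairing ρ z ξ w = relPairing ρ z ξ' w := by
  obtain ⟨-, η, hη⟩ := hw
  simp only [relPairing]
  congr 1
  refine Finset.sum_congr rfl fun i _ => ?_
  rw [← sub_eq_zero, ← killing_sub_left, (hη i).2, killing_sub_right]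
  have e : Ad (ρ.1 (mer i)) (ξ i - ξ' i) = ξ i - ξ' i := by
    have := (h i).2.symm.trans (h' i).2
    rw [map_sub]
    rw [sub_eq_sub_iff_add_eq_add] at this ⊢
    rw [this, add_comm]
  nth_rewrite 1 [← e]
  rw [killing_Ad, sub_self]

theorem relPairing_add_left (ρ : RepSpace) (z z' w : SurfaceGroup → ℍ[ℝ])
    (ξ ξ' : Fin 4 → ℍ[ℝ]) :
    relPairing ρ (z + z') (ξ + ξ') w = relPairing ρ z ξ w + relPairing ρ z' ξ' w := by
  simp only [relPairing, fundChain, List.map_cons, List.map_nil, List.sum_cons, List.sum_nil,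
    Fin.sum_univ_four, Pi.add_apply, killing_add_left]
  ring

theorem relPairing_smul_left (ρ : RepSpace) (r : ℝ) (z w : SurfaceGroup → ℍ[ℝ])
    (ξ : Fin 4 → ℍ[ℝ]) : relPairing ρ (r • z) (r • ξ) w = r * relPairing ρ z ξ w := by
  simp only [relPairing, fundChain, List.map_cons, List.map_nil, List.sum_cons, List.sum_nil,
    Fin.sum_univ_four, Pi.smul_apply, killing_smul_left]
  ring

theorem relPairing_add_right (ρ : RepSpace) (z w w' : SurfaceGroup → ℍ[ℝ])
    (ξ : Fin 4 → ℍ[ℝ]) :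
    relPairing ρ z ξ (w + w') = relPairing ρ z ξ w + relPairing ρ z ξ w' := by
  simp only [relPairing, fundChain, List.map_cons, List.map_nil, List.sum_cons, List.sum_nil,
    Fin.sum_univ_four, Pi.add_apply, killing_add_right, map_add]
  ring

theorem relPairing_smul_right (ρ : RepSpace) (r : ℝ) (z w : SurfaceGroup → ℍ[ℝ])
    (ξ : Fin 4 → ℍ[ℝ]) : relPairing ρ z ξ (r • w) = r * relPairing ρ z ξ w := by
  simp only [relPairing, fundChain, List.map_cons, List.map_nil, List.sum_cons, List.sum_nil,
    Fin.sum_univ_four, Pi.smul_apply, killing_smul_right, map_smul]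
  ring

theorem relPairing_coboundary_left (ρ : RepSpace) {z w : SurfaceGroup → ℍ[ℝ]} {η : ℍ[ℝ]}
    (hz : ∀ g, z g = Ad (ρ.1 g) η - η) (hw : w ∈ Cocycle ρ) :
    relPairing ρ z (fun _ => η) w = 0 := by
  have key := fundChain_boundary fun g => killing η (w g)
  have e : ∀ g h, killing (z g) (Ad (ρ.1 g) (w h))
      = killing η (w h) - killing η (w (g * h)) + killing η (w g) := by
    intro g h
    rw [hz, killing_sub_left, killing_Ad, hw.2, killing_add_right]
    ring
  simp only [relPairing, e]
  rw [key, sub_self]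

theorem relPairing_coboundary_right (ρ : RepSpace) {z w : SurfaceGroup → ℍ[ℝ]}
    {ξ : Fin 4 → ℍ[ℝ]} {η : ℍ[ℝ]} (hz : z ∈ Cocycle ρ) (hξ : IsRelLift ρ z ξ)
    (hw : ∀ g, w g = Ad (ρ.1 g) η - η) : relPairing ρ z ξ w = 0 := by
  have key := fundChain_boundary fun g => -killing (z g) (Ad (ρ.1 g) η)
  have e : ∀ g h, killing (z g) (Ad (ρ.1 g) (w h))
      = -killing (z h) (Ad (ρ.1 h) η) - -killing (z (g * h)) (Ad (ρ.1 (g * h)) η)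
        + -killing (z g) (Ad (ρ.1 g) η) := by
    intro g h
    rw [hw, hz.2, map_mul, Ad_mul, map_sub, killing_sub_right, killing_add_left, killing_Ad]
    ring
  have e' : ∀ i, killing (ξ i) (w (mer i)) = -killing (z (mer i)) (Ad (ρ.1 (mer i)) η) := by
    intro i
    rw [hw, (hξ i).2, killing_sub_right, killing_sub_left, killing_Ad]
    ring
  simp only [relPairing, e, e']
  rw [key, sub_self]

/-- The pairing on parabolic cocycles; the choice of `ξ` is immaterial. -/
def parPairing (ρ : RepSpace) : ParCocycle ρ →ₗ[ℝ] ParCocycle ρ →ₗ[ℝ] ℝ :=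
  LinearMap.mk₂ ℝ (fun z w => relPairing ρ z.1 z.2.2.choose w.1)
    (fun z z' w => by
      rw [← relPairing_add_left]
      refine relPairing_lift_indep ρ (z + z').2.2.choose_spec (fun i => ?_) w.2
      have h := z.2.2.choose_spec i
      have h' := z'.2.2.choose_spec i
      refine ⟨su2.add_mem h.1 h'.1, ?_⟩
      simp only [Submodule.coe_add, Pi.add_apply, map_add]
      rw [h.2, h'.2]
      abel)
    (fun r z w => by
      rw [smul_eq_mul, ← relPairing_smul_left]
      refine relPairing_lift_indep ρ (r • z).2.2.choose_spec (fun i => ?_) w.2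
      have h := z.2.2.choose_spec i
      refine ⟨su2.smul_mem r h.1, ?_⟩
      simp only [Submodule.coe_smul, Pi.smul_apply, map_smul]
      rw [h.2, smul_sub])
    (fun z w w' => relPairing_add_right ρ _ _ _ _)
    (fun r z w => relPairing_smul_right ρ r _ _ _)

/-- The Atiyah–Bott–Goldman form `ω̂` on the formal tangent space `Ĥ¹(F; su(2)_{Ad ρ})`: the form
induced by the cohomology intersection pairing on `H¹(F, ∂F)`. -/
def abgForm (ρ : RepSpace) : Hhat ρ →ₗ[ℝ] Hhat ρ →ₗ[ℝ] ℝ :=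
  Submodule.liftQ _
    (LinearMap.flip (Submodule.liftQ _ (parPairing ρ).flip (by
      rintro w ⟨η, -, hw⟩
      ext z
      exact relPairing_coboundary_right ρ z.2.1 z.2.2.choose_spec hw)))
    (by
      rintro z ⟨η, hη, hz⟩
      ext w
      exact (relPairing_lift_indep ρ z.2.2.choose_spec (fun i => ⟨hη, hz (mer i)⟩) w.2).trans
        (relPairing_coboundary_left ρ hz w.2.1))

/-- On classes of parabolic cocycles the form is given by the pairing of cocycles. -/
theorem abgForm_mk (ρ : RepSpace) (z w : ParCocycle ρ) (ξ : Fin 4 → ℍ[ℝ])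
    (hξ : IsRelLift ρ z.1 ξ) :
    abgForm ρ (Submodule.Quotient.mk z) (Submodule.Quotient.mk w) = relPairing ρ z.1 ξ w.1 :=
  relPairing_lift_indep ρ z.2.2.choose_spec hξ w.2

/-! ## The action of automorphisms of the surface group on the character variety -/

/-- Automorphisms of the surface group that permute the conjugacy classes of the meridians. -/
def peripheralAut : Subgroup (MulAut SurfaceGroup) where
  carrier := {φ | ∃ s : Equiv.Perm (Fin 4), ∀ i, IsConj (mer (s i)) (φ (mer i))}
  mul_mem' := by
    rintro φ ψ ⟨s, hs⟩ ⟨t, ht⟩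
    refine ⟨s * t, fun i => ?_⟩
    exact (hs (t i)).trans (MonoidHom.map_isConj (φ : SurfaceGroup →* SurfaceGroup) (ht i))
  one_mem' := ⟨1, fun i => IsConj.refl _⟩
  inv_mem' := by
    rintro φ ⟨s, hs⟩
    refine ⟨s⁻¹, fun i => ?_⟩
    have h := MonoidHom.map_isConj
      ((φ⁻¹ : MulAut SurfaceGroup) : SurfaceGroup →* SurfaceGroup) (hs (s⁻¹ i))
    have e : s (s⁻¹ i) = i := by simp
    rw [e] at h
    have e' : ((φ⁻¹ : MulAut SurfaceGroup) : SurfaceGroup →* SurfaceGroup) (φ (mer (s⁻¹ i)))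
        = mer (s⁻¹ i) := MulAut.inv_apply_self _ _ _
    rw [e'] at h
    exact h.symm

theorem halfTwist₁_mem : halfTwist₁ ∈ peripheralAut := by
  refine ⟨Equiv.swap 2 3, fun i => ?_⟩
  rw [halfTwist₁_mer, ← mer_three]
  fin_cases i
  · exact IsConj.refl _
  · exact IsConj.refl _
  · exact IsConj.refl _
  · exact isConj_iff.2 ⟨(mer 3)⁻¹, by simp [Equiv.swap_apply_right]⟩

theorem halfTwist₂_mem : halfTwist₂ ∈ peripheralAut := by
  refine ⟨Equiv.swap 1 3, fun i => ?_⟩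
  rw [halfTwist₂_mer]
  fin_cases i
  · exact IsConj.refl _
  · exact isConj_iff.2 ⟨mer 2, by
      simp only [Fin.mk_one, Equiv.swap_apply_left, Matrix.cons_val, mer_three]; group⟩
  · exact IsConj.refl _
  · exact isConj_iff.2 ⟨mer 0, by simp [Equiv.swap_apply_right]⟩

theorem re_conj (g q : SU2) : ((g * q * g⁻¹ : SU2) : ℍ[ℝ]).re = (q : ℍ[ℝ]).re := by
  rw [Submonoid.coe_mul, re_mul_comm, ← Submonoid.coe_mul]
  simp

/-- Precomposition `ρ ↦ ρ ∘ φ` on representations. -/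
def pullRep (φ : peripheralAut) (ρ : RepSpace) : RepSpace :=
  ⟨ρ.1.comp (φ.1 : SurfaceGroup →* SurfaceGroup), fun i => by
    obtain ⟨s, hs⟩ := φ.2
    obtain ⟨g, hg⟩ := isConj_iff.1 (hs i)
    simp only [MonoidHom.comp_apply, MonoidHom.coe_coe]
    rw [← hg, map_mul, map_mul, map_inv, re_conj]
    exact ρ.2 _⟩

theorem continuous_pullRep (φ : peripheralAut) : Continuous (pullRep φ) := by
  refine continuous_induced_rng.2 (continuous_pi fun g => ?_)
  exact (continuous_apply (φ.1 g)).comp continuous_induced_dom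

/-- The map `φ^* : χ(S², 4) → χ(S², 4)`, `[ρ] ↦ [ρ ∘ φ]`. -/
def pullCls (φ : peripheralAut) : CharVar → CharVar :=
  Quotient.map (pullRep φ) (by
    rintro ρ σ ⟨g, hg⟩
    exact ⟨g, fun x => hg (φ.1 x)⟩)

theorem continuous_pullCls (φ : peripheralAut) : Continuous (pullCls φ) :=
  (continuous_pullRep φ).quotient_map' _

theorem pullCls_mul (φ ψ : peripheralAut) (x : CharVar) :
    pullCls (φ * ψ) x = pullCls ψ (pullCls φ x) := by
  induction x using Quotient.inductionOn with
  | h ρ => rfl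

theorem pullCls_one (x : CharVar) : pullCls 1 x = x := by
  induction x using Quotient.inductionOn with
  | h ρ => rfl

/-- The self-homeomorphism `[ρ] ↦ [ρ ∘ φ]` of the character variety. -/
def pullback (φ : peripheralAut) : CharVar ≃ₜ CharVar where
  toFun := pullCls φ
  invFun := pullCls φ⁻¹
  left_inv x := by rw [← pullCls_mul, mul_inv_cancel, pullCls_one]
  right_inv x := by rw [← pullCls_mul, inv_mul_cancel, pullCls_one]
  continuous_toFun := continuous_pullCls φ
  continuous_invFun := continuous_pullCls φ⁻¹

/-- The homeomorphism of the character variety induced by the half Dehn twist in `H₁`. -/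
def twistAction₁ : CharVar ≃ₜ CharVar := pullback ⟨halfTwist₁, halfTwist₁_mem⟩

/-- The homeomorphism of the character variety induced by the half Dehn twist in `H₂`. -/
def twistAction₂ : CharVar ≃ₜ CharVar := pullback ⟨halfTwist₂, halfTwist₂_mem⟩

/-! ## The pillowcase -/

/-- The elliptic involution of the torus `U(1) × U(1)`. -/
def ellInv (t : Circle × Circle) : Circle × Circle := (t.1⁻¹, t.2⁻¹)

theorem ellInv_ellInv (t : Circle × Circle) : ellInv (ellInv t) = t := by simp [ellInv]

/-- Two points of the torus are equivalent when they agree up to the elliptic involution. -/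
instance torusSetoid : Setoid (Circle × Circle) where
  r s t := t = s ∨ t = ellInv s
  iseqv :=
    { refl := fun _ => Or.inl rfl
      symm := by
        rintro s t (rfl | rfl)
        · exact Or.inl rfl
        · exact Or.inr (ellInv_ellInv s).symm
      trans := by
        rintro s t u (rfl | rfl) (rfl | rfl)
        · exact Or.inl rfl
        · exact Or.inr rfl
        · exact Or.inr rfl
        · exact Or.inl (ellInv_ellInv s) }

/-- The pillowcase `ℙ`, the quotient of the torus by the elliptic involution. -/
abbrev Pillow : Type := Quotient torusSetoid

/-- `ℙ*`: the pillowcase with the images of the four fixed points of the involution removed. -/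
def pillowReg : Set Pillow := {p | ∃ t, ellInv t ≠ t ∧ p = Quotient.mk torusSetoid t}

/-- The action of `SL(2, ℤ)` on the torus: the matrix with rows `(p, r)` and `(q, s)` sends
`(e^{ix}, e^{iy})` to `(e^{i(px + ry)}, e^{i(qx + sy)})`. -/
def slTorus (A : SL(2, ℤ)) (t : Circle × Circle) : Circle × Circle :=
  (t.1 ^ (A 0 0) * t.2 ^ (A 0 1), t.1 ^ (A 1 0) * t.2 ^ (A 1 1))

theorem slTorus_mul (A B : SL(2, ℤ)) (t : Circle × Circle) :
    slTorus (A * B) t = slTorus A (slTorus B t) := by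
  have e : ∀ (x y : Circle) (k l p q r s : ℤ),
      x ^ (k * p + l * r) * y ^ (k * q + l * s) = (x ^ p * y ^ q) ^ k * (x ^ r * y ^ s) ^ l := by
    intro x y k l p q r s
    rw [mul_zpow, mul_zpow, ← zpow_mul, ← zpow_mul, ← zpow_mul, ← zpow_mul, zpow_add, zpow_add,
      mul_comm p, mul_comm q, mul_comm r, mul_comm s]
    exact mul_mul_mul_comm _ _ _ _
  ext1
  · simp only [slTorus, Matrix.SpecialLinearGroup.coe_mul, Matrix.mul_apply, Fin.sum_univ_two, e]
  · simp only [slTorus, Matrix.SpecialLinearGroup.coe_mul, Matrix.mul_apply, Fin.sum_univ_two, e]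

theorem slTorus_one (t : Circle × Circle) : slTorus 1 t = t := by
  ext1 <;> simp [slTorus]

theorem slTorus_ellInv (A : SL(2, ℤ)) (t : Circle × Circle) :
    slTorus A (ellInv t) = ellInv (slTorus A t) := by
  ext1 <;> simp [slTorus, ellInv, mul_comm]

/-- The action of `SL(2, ℤ)` on the pillowcase. -/
def slPillow : SL(2, ℤ) →* Equiv.Perm Pillow :=
  letI : MulAction SL(2, ℤ) Pillow :=
    { smul := fun A => Quotient.map (slTorus A) (by
        rintro s t (rfl | rfl)
        · exact Or.inl rfl
        · exact Or.inr (slTorus_ellInv A s))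
      one_smul := by
        intro p
        induction p using Quotient.inductionOn with
        | h t => exact congrArg (Quotient.mk torusSetoid) (slTorus_one t)
      mul_smul := by
        intro A B p
        induction p using Quotient.inductionOn with
        | h t => exact congrArg (Quotient.mk torusSetoid) (slTorus_mul A B t) }
  MulAction.toPermHom SL(2, ℤ) Pillow

theorem slPillow_mk (A : SL(2, ℤ)) (t : Circle × Circle) :
    slPillow A (Quotient.mk torusSetoid t) = Quotient.mk torusSetoid (slTorus A t) := rfl

/-- The group `PSL(2, ℤ) = SL(2, ℤ) / {±1}`. -/
abbrev PSL2Z : Type := Matrix.ProjectiveSpecialLinearGroup (Fin 2) ℤ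

theorem slPillow_center : Subgroup.center SL(2, ℤ) ≤ slPillow.ker := by
  intro A hA
  obtain ⟨r, hr, hA⟩ := Matrix.SpecialLinearGroup.mem_center_iff.1 hA
  rw [MonoidHom.mem_ker]
  ext p
  induction p using Quotient.inductionOn with
  | h t =>
    rw [slPillow_mk]
    have h00 : A 0 0 = r := (congrFun (congrFun hA 0) 0).symm
    have h01 : A 0 1 = 0 := (congrFun (congrFun hA 0) 1).symm
    have h10 : A 1 0 = 0 := (congrFun (congrFun hA 1) 0).symm
    have h11 : A 1 1 = r := (congrFun (congrFun hA 1) 1).symm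
    have hr' : r = 1 ∨ r = -1 := by
      simpa using hr
    refine Quotient.sound (Setoid.symm ?_)
    rcases hr' with rfl | rfl
    · left; ext1 <;> simp [slTorus, *]
    · right; ext1 <;> simp [slTorus, ellInv, *]

/-- The action of `PSL(2, ℤ)` on the pillowcase. -/
def pslPillow : PSL2Z →* Equiv.Perm Pillow :=
  QuotientGroup.lift (Subgroup.center SL(2, ℤ)) slPillow slPillow_center

/-! ## The map from the pillowcase to the character variety -/

theorem mem_unitary_of_normSq {q : ℍ[ℝ]} (h : Quaternion.normSq q = 1) : q ∈ unitary ℍ[ℝ] := by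
  rw [Unitary.mem_iff, Quaternion.star_mul_self, Quaternion.self_mul_star, h]
  simp

/-- The quaternion `j`. -/
def quatJ : ℍ[ℝ] := ⟨0, 0, 1, 0⟩

theorem quatJ_re : quatJ.re = 0 := rfl
theorem quatJ_imI : quatJ.imI = 0 := rfl
theorem quatJ_imJ : quatJ.imJ = 1 := rfl
theorem quatJ_imK : quatJ.imK = 0 := rfl

theorem circle_re_im (z : Circle) :
    (z : ℂ).re * (z : ℂ).re + (z : ℂ).im * (z : ℂ).im = 1 := by
  rw [← Complex.normSq_apply]; exact Circle.normSq_coe z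

/-- The unit quaternion `e^{ix} j`, for `z = e^{ix}` a unit complex number. -/
def circJ (z : Circle) : SU2 :=
  ⟨((z : ℂ) : ℍ[ℝ]) * quatJ, mem_unitary_of_normSq (by
    have h := circle_re_im z
    rw [map_mul, Quaternion.normSq_def', Quaternion.normSq_def']
    simp [quatJ_re, quatJ_imI, quatJ_imJ, quatJ_imK]
    linarith)⟩

theorem circJ_re (z : Circle) : (circJ z : ℍ[ℝ]).re = 0 := by
  simp [circJ, quatJ_re, quatJ_imI, quatJ_imJ, quatJ_imK]
theorem circJ_imI (z : Circle) : (circJ z : ℍ[ℝ]).imI = 0 := by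
  simp [circJ, quatJ_re, quatJ_imI, quatJ_imJ, quatJ_imK]
theorem circJ_imJ (z : Circle) : (circJ z : ℍ[ℝ]).imJ = (z : ℂ).re := by
  simp [circJ, quatJ_re, quatJ_imI, quatJ_imJ, quatJ_imK]
theorem circJ_imK (z : Circle) : (circJ z : ℍ[ℝ]).imK = (z : ℂ).im := by
  simp [circJ, quatJ_re, quatJ_imI, quatJ_imJ, quatJ_imK]

theorem circJ_rel (z w : Circle) :
    circJ 1 * circJ z * circJ w * circJ (w * z⁻¹) = 1 := by
  have hz := circle_re_im z
  have hw := circle_re_im w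
  apply Subtype.ext
  have h : (circJ 1 : ℍ[ℝ]) * circJ z * circJ w * circJ (w * z⁻¹) = 1 := by
    ext <;> simp only [Quaternion.re_mul, Quaternion.imI_mul, Quaternion.imJ_mul,
      Quaternion.imK_mul, circJ_re, circJ_imI, circJ_imJ, circJ_imK, Circle.coe_mul,
      Circle.coe_inv_eq_conj, Complex.mul_re, Complex.mul_im, Complex.conj_re, Complex.conj_im,
      Circle.coe_one, Complex.one_re, Complex.one_im, Quaternion.re_one, Quaternion.imI_one,
      Quaternion.imJ_one, Quaternion.imK_one]
    · linear_combination hw + ((w : ℂ).re * (w : ℂ).re + (w : ℂ).im * (w : ℂ).im) * hz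
    · ring
    · ring
    · ring
  exact h

theorem circJ_conj (z : Circle) : circJ z⁻¹ = circJ 1 * circJ z * (circJ 1)⁻¹ := by
  rw [eq_mul_inv_iff_mul_eq]
  apply Subtype.ext
  have h : (circJ z⁻¹ : ℍ[ℝ]) * circJ 1 = circJ 1 * circJ z := by
    ext <;> simp only [Quaternion.re_mul, Quaternion.imI_mul, Quaternion.imJ_mul,
      Quaternion.imK_mul, circJ_re, circJ_imI, circJ_imJ, circJ_imK,
      Circle.coe_inv_eq_conj, Complex.conj_re, Complex.conj_im,
      Circle.coe_one, Complex.one_re, Complex.one_im] <;> ring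
  exact h

/-- The representation `a ↦ j, b ↦ e^{ix} j, c ↦ e^{iy} j` attached to the point `(e^{ix}, e^{iy})`
of the torus; the relation `a b c d = 1` forces `d ↦ e^{i(y - x)} j`. -/
def torusRep (t : Circle × Circle) : RepSpace :=
  ⟨homOfMer (circJ 1) (circJ t.1) (circJ t.2) (circJ (t.2 * t.1⁻¹)) (circJ_rel t.1 t.2), by
    intro i
    rw [homOfMer_mer]
    fin_cases i <;> exact circJ_re _⟩

theorem torusRep_ellInv (t : Circle × Circle) (x : SurfaceGroup) :
    (torusRep (ellInv t)).1 x = circJ 1 * (torusRep t).1 x * (circJ 1)⁻¹ := by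
  have h : (torusRep (ellInv t)).1 = (MulAut.conj (circJ 1)).toMonoidHom.comp (torusRep t).1 := by
    apply hom_ext_mer
    intro i
    rw [MonoidHom.comp_apply]
    simp only [torusRep]
    rw [homOfMer_mer, homOfMer_mer]
    have e : ∀ z, (MulAut.conj (circJ 1)).toMonoidHom (circJ z) = circJ z⁻¹ := fun z =>
      (circJ_conj z).symm
    fin_cases i
    · exact (congrArg circJ inv_one.symm).trans (e 1).symm
    · exact (e t.1).symm
    · exact (e t.2).symm
    · exact (congrArg circJ (by simp [ellInv, mul_comm])).trans (e (t.2 * t.1⁻¹)).symm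
  rw [h]; rfl

/-- The map `ρ̂ : ℙ → χ(S², 4)`,
`[e^{ix}, e^{iy}] ↦ [a ↦ j, b ↦ e^{ix} j, c ↦ e^{iy} j]`. -/
def rhoHat : Pillow → CharVar :=
  Quotient.map torusRep (by
    rintro s t (rfl | rfl)
    · exact Setoid.refl _
    · exact ⟨circJ 1, torusRep_ellInv s⟩)

/-! ## Regular points, smooth functions and symplectomorphisms -/

/-- `χ(S², 4)*`, the smooth top stratum: the set of regular points, those with a neighborhood on
which the dimension of `Ĥ¹` is constant. -/
def regSet : Set CharVar :=
  {x | ∃ U ∈ 𝓝 x, ∃ n : ℕ, ∀ ρ, cls ρ ∈ U → Module.finrank ℝ (Hhat ρ) = n}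

/-- The values of a representation on the four meridians, as a point of `ℍ⁴`. -/
def coords (ρ : RepSpace) (i : Fin 4) : ℍ[ℝ] := ρ.1 (mer i)

/-- A real function on the character variety is smooth near the class of `ρ` when its pullback to
the space of representations is, near `ρ`, the restriction of a smooth function on the ambient
Euclidean space `ℍ⁴`. On the regular points these are the smooth functions of the quotient
manifold structure. -/
def SmoothAtRep (f : CharVar → ℝ) (ρ : RepSpace) : Prop :=
  ∃ F : (Fin 4 → ℍ[ℝ]) → ℝ, ContDiff ℝ ∞ F ∧ ∀ᶠ σ in 𝓝 ρ, f (cls σ) = F (coords σ)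

/-- The universal covering `(x, y) ↦ (e^{ix}, e^{iy})` of the torus. -/
def expT (u : ℝ × ℝ) : Circle × Circle := (Circle.exp u.1, Circle.exp u.2)

/-- The point `[e^{ix}, e^{iy}]` of the pillowcase. -/
def pillowPt (u : ℝ × ℝ) : Pillow := Quotient.mk torusSetoid (expT u)

/-- A real function on the pillowcase is smooth near `[e^{ix}, e^{iy}]` when it is a smooth function
of the coordinates `x, y` there. (Used on `ℙ*`, where `x, y` are local coordinates.) -/
def SmoothAtPillow (f : Pillow → ℝ) (u : ℝ × ℝ) : Prop :=
  ∃ F : ℝ × ℝ → ℝ, ContDiff ℝ ∞ F ∧ ∀ᶠ v in 𝓝 u, f (pillowPt v) = F v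

/-- A two-parameter family of representations that is smooth on `U`. -/
def SmoothFamilyOn (U : Set (ℝ × ℝ)) (m : ℝ × ℝ → RepSpace) : Prop :=
  ContDiffOn ℝ ∞ (fun u => coords (m u)) U

/-- The derivative of a family of representations at `u` in the direction `v`, right translated
to the identity: `g ↦ (∂_v m(g)) m(g)⁻¹`. If `m_s = exp(α_s) m_0` along a curve, this is the
derivative of `α_s` at `s = 0`. -/
def velocity (m : ℝ × ℝ → RepSpace) (u v : ℝ × ℝ) (g : SurfaceGroup) : ℍ[ℝ] :=
  fderiv ℝ (fun u' => ((m u').1 g : ℍ[ℝ])) u v * star ((m u).1 g : ℍ[ℝ])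

open Classical in
/-- The tangent vector to the character variety represented by the derivative of a family of
representations in the direction `v`: the class of `velocity` in `Ĥ¹`. (The velocity of a
differentiable family is a parabolic cocycle; the other case is a dummy value.) -/
def tangentClass (m : ℝ × ℝ → RepSpace) (u v : ℝ × ℝ) : Hhat (m u) :=
  if h : velocity m u v ∈ ParCocycle (m u) then Submodule.Quotient.mk ⟨velocity m u v, h⟩ else 0

/-- The value at `u`, on the vectors `v` and `w`, of the pullback to the parameter plane of the
Atiyah–Bott–Goldman form along the family `u ↦ [m u]`. It depends only on the family of classes
`[m u]`. -/
def pulledBackForm (m : ℝ × ℝ → RepSpace) (u v w : ℝ × ℝ) : ℝ :=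
  abgForm (m u) (tangentClass m u v) (tangentClass m u w)

/-- A self-homeomorphism `Φ` of the character variety which preserves the Atiyah–Bott–Goldman form:
it restricts to a diffeomorphism of the set of regular points, and every smooth two-parameter
family of regular representations is carried by `Φ` to a family of classes that is again, locally,
represented by a smooth family, along which the form has the same pullback. -/
structure PreservesABG (Φ : CharVar ≃ₜ CharVar) : Prop where
  maps_reg : Φ '' regSet = regSet
  smooth_iff : ∀ ρ σ : RepSpace, cls ρ ∈ regSet → cls σ = Φ (cls ρ) →
    ∀ f : CharVar → ℝ, SmoothAtRep f σ ↔ SmoothAtRep (f ∘ Φ) ρ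
  form_eq : ∀ (U : Set (ℝ × ℝ)) (m : ℝ × ℝ → RepSpace), IsOpen U → SmoothFamilyOn U m →
    (∀ u ∈ U, cls (m u) ∈ regSet) → ∀ u₀ ∈ U,
    ∃ (V : Set (ℝ × ℝ)) (m' : ℝ × ℝ → RepSpace), IsOpen V ∧ u₀ ∈ V ∧ V ⊆ U ∧
      SmoothFamilyOn V m' ∧ (∀ u ∈ V, cls (m' u) = Φ (cls (m u))) ∧
      ∀ u ∈ V, ∀ v w, pulledBackForm m' u v w = pulledBackForm m u v w

/-- `ρ̂` is a homeomorphism of the pillowcase onto the character variety that restricts to a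
symplectomorphism from `(ℙ*, c dx ∧ dy)` onto `(χ(S², 4)*, ω̂)`: it maps `ℙ*` onto the regular points,
is a diffeomorphism there, and at each point of `ℙ*` its differential (computed with the lift
`(x, y) ↦ (a ↦ j, b ↦ e^{ix} j, c ↦ e^{iy} j)` of `ρ̂`) is an isomorphism onto the formal
tangent space that pulls `ω̂` back to `c dx ∧ dy`. -/
structure IsPillowSymplectomorphism (c : ℝ) : Prop where
  homeo : IsHomeomorph rhoHat
  maps_reg : rhoHat '' pillowReg = regSet
  smooth_iff : ∀ u, pillowPt u ∈ pillowReg →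
    ∀ f : CharVar → ℝ, SmoothAtRep f (torusRep (expT u)) ↔ SmoothAtPillow (f ∘ rhoHat) u
  smooth_lift : SmoothFamilyOn Set.univ (fun u => torusRep (expT u))
  differential_mem : ∀ u v, velocity (fun u => torusRep (expT u)) u v ∈ ParCocycle (torusRep (expT u))
  differential_bijective : ∀ u, pillowPt u ∈ pillowReg →
    Function.Bijective (tangentClass (fun u => torusRep (expT u)) u)
  form_eq : ∀ u, pillowPt u ∈ pillowReg → ∀ v w : ℝ × ℝ,
    pulledBackForm (fun u => torusRep (expT u)) u v w = c * (v.1 * w.2 - v.2 * w.1)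

end FourPunctured

end

/-! The real part of a product of three imaginary quaternions is minus their triple product. Since
ABC = D⁻¹ is traceless, the images A, B, C of a, b, c lie in one plane; rotating A to j and a normal
of the plane to i brings any representation to the form `torusRep t`. The inner products {A,B},
{A,C}, {B,C} are then cos x, cos y, cos(x - y), which determine (x, y) up to a common sign. They
also map the character variety injectively and continuously to ℝ³, so it is Hausdorff, and `rhoHat`,
a continuous bijection from a compact space, is a homeomorphism.

The half twists carry torus representations to torus representations exactly, not just up to
conjugacy, through the matrices `slTwist₁` and `slTwist₂`, because d ↦ e^{i(y-x)}j and conjugation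
by e^{iy}j reflects the circle of the elements e^{iθ}j. These matrices generate SL(2, ℤ), so the
action transported from the pillowcase is the one generated by the twists. It is faithful because
e^i has infinite order.

Invariance of the form is proved on the chain level for arbitrary parabolic cocycles. A half twist
changes the relative fundamental chain only by terms controlled by the cocycle identity
`cup_cocycle` and the conjugation identity `cup_braid`. Automorphisms preserving the pairing are
closed under products and inverses, and composition with an automorphism acts on velocities by
composition.

Along the torus family the velocity takes values in ℝi on the meridians, each of which acts on ℝi by
-1; the pairing becomes -½ dx ∧ dy, and nondegeneracy makes the differential injective. Off the
corners every parabolic cocycle is a velocity plus a coboundary (`exists_velocity_add_coboundary`),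
so the formal tangent space has dimension 2. At a corner the stabilizer rotates a velocity into a
third independent class. Corners are limits of other points, so the regular points are exactly the
image of the punctured pillowcase. Smooth functions correspond because x and y are locally smooth
functions of the inner products (`localAngles`). -/

noncomputable section

namespace FourPunctured

/-! ## Quaternion components -/

/-- The quaternion with the given components. -/
def quat (a b c d : ℝ) : ℍ[ℝ] := ⟨a, b, c, d⟩

@[simp] theorem quat_re (a b c d : ℝ) : (quat a b c d).re = a := rfl
@[simp] theorem quat_imI (a b c d : ℝ) : (quat a b c d).imI = b := rfl
@[simp] theorem quat_imJ (a b c d : ℝ) : (quat a b c d).imJ = c := rfl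
@[simp] theorem quat_imK (a b c d : ℝ) : (quat a b c d).imK = d := rfl

theorem quaternion_ext {p q : ℍ[ℝ]} (h₀ : p.re = q.re) (h₁ : p.imI = q.imI) (h₂ : p.imJ = q.imJ)
    (h₃ : p.imK = q.imK) : p = q := by
  ext
  exacts [h₀, h₁, h₂, h₃]

/-! ## Words in the meridians -/

theorem su2_ext {g h : SU2} (h₀ : (g : ℍ[ℝ]).re = (h : ℍ[ℝ]).re)
    (h₁ : (g : ℍ[ℝ]).imI = (h : ℍ[ℝ]).imI) (h₂ : (g : ℍ[ℝ]).imJ = (h : ℍ[ℝ]).imJ)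
    (h₃ : (g : ℍ[ℝ]).imK = (h : ℍ[ℝ]).imK) : g = h :=
  Subtype.ext (quaternion_ext h₀ h₁ h₂ h₃)

theorem coe_inv_su2 (g : SU2) : ((g⁻¹ : SU2) : ℍ[ℝ]) = star (g : ℍ[ℝ]) := rfl

theorem contDiff_star_quaternion : ContDiff ℝ ∞ (fun q : ℍ[ℝ] => star q) := by
  have h : (fun q : ℍ[ℝ] => star q) =
      fun q => (2 * inner ℝ q (1 : ℍ[ℝ])) • (1 : ℍ[ℝ]) - q := by
    funext q
    ext <;> simp [Quaternion.inner_def]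
    ring
  rw [h]
  exact ((contDiff_const.mul (contDiff_id.inner ℝ contDiff_const)).smul contDiff_const).sub
    contDiff_id

theorem contDiff_re : ContDiff ℝ ∞ (fun q : ℍ[ℝ] => q.re) := by
  have h : (fun q : ℍ[ℝ] => q.re) = fun q => inner ℝ q (1 : ℍ[ℝ]) := by
    funext q; simp [Quaternion.inner_def]
  rw [h]
  exact contDiff_id.inner ℝ contDiff_const

/-- The value of a representation on a group element is a smooth function of its values on the
meridians. -/
theorem exists_smooth_word (g : SurfaceGroup) :
    ∃ W : (Fin 4 → ℍ[ℝ]) → ℍ[ℝ], ContDiff ℝ ∞ W ∧ ∀ ρ : RepSpace, (ρ.1 g : ℍ[ℝ]) = W (coords ρ) := by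
  have hg : g ∈ Subgroup.closure (Set.range (PresentedGroup.of (rels := relators))) := by
    rw [PresentedGroup.closure_range_of]; trivial
  induction hg using Subgroup.closure_induction with
  | mem x hx =>
    obtain ⟨i, rfl⟩ := hx
    exact ⟨fun c => c i, contDiff_apply ℝ _ i, fun ρ => rfl⟩
  | one => exact ⟨fun _ => 1, contDiff_const, fun ρ => by simp⟩
  | mul x y _ _ hx hy =>
    obtain ⟨V, hV, hV'⟩ := hx
    obtain ⟨W, hW, hW'⟩ := hy
    exact ⟨fun c => V c * W c, hV.mul hW, fun ρ => by rw [map_mul, Submonoid.coe_mul, hV', hW']⟩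
  | inv x _ hx =>
    obtain ⟨V, hV, hV'⟩ := hx
    -- The inverse of a unit quaternion is its conjugate, so the word extends smoothly to all of ℍ⁴,
    -- including points with vanishing entries.
    exact ⟨fun c => star (V c), contDiff_star_quaternion.comp hV, fun ρ => by
      rw [map_inv, coe_inv_su2, hV']⟩

theorem continuous_coords : Continuous coords := by
  refine continuous_pi fun i => ?_
  have h : Continuous fun ρ : RepSpace => (fun g : SurfaceGroup => ρ.1 g) := continuous_induced_dom
  exact continuous_subtype_val.comp ((continuous_apply (mer i)).comp h)

/-- Pointwise convergence on the whole group follows from convergence on the meridians, since words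
are continuous in them. -/
theorem continuous_of_coords {X : Type*} [TopologicalSpace X] {m : X → RepSpace}
    (h : Continuous fun x => coords (m x)) : Continuous m := by
  refine continuous_induced_rng.2 (continuous_pi fun g => ?_)
  refine Continuous.subtype_mk (p := fun q : ℍ[ℝ] => q ∈ unitary ℍ[ℝ])
    (f := fun x => ((m x).1 g : ℍ[ℝ])) ?_ (fun x => ((m x).1 g).2)
  obtain ⟨W, hW, hW'⟩ := exists_smooth_word g
  simp only [hW']
  exact hW.continuous.comp h

theorem coords_torusRep (t : Circle × Circle) (i : Fin 4) :
    coords (torusRep t) i =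
      ((![circJ 1, circJ t.1, circJ t.2, circJ (t.2 * t.1⁻¹)] i : SU2) : ℍ[ℝ]) := by
  simp only [coords, torusRep]
  rw [homOfMer_mer]

theorem continuous_torusRep : Continuous torusRep := by
  have hJ : Continuous fun z : Circle => (circJ z : ℍ[ℝ]) := by
    have : Continuous fun z : Circle => ((z : ℂ) : ℍ[ℝ]) := by
      have h1 : Continuous fun z : ℂ => (z : ℍ[ℝ]) :=
        Quaternion.ofComplex.toLinearMap.continuous_of_finiteDimensional
      exact h1.comp continuous_subtype_val
    exact this.mul continuous_const
  refine continuous_of_coords (continuous_pi fun i => ?_)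
  simp only [coords_torusRep]
  fin_cases i
  · exact continuous_const
  · exact hJ.comp continuous_fst
  · exact hJ.comp continuous_snd
  · exact hJ.comp (continuous_snd.mul continuous_fst.inv)

theorem rhoHat_mk (t : Circle × Circle) :
    rhoHat (Quotient.mk torusSetoid t) = cls (torusRep t) := rfl

theorem continuous_rhoHat : Continuous rhoHat :=
  continuous_torusRep.quotient_map' _

/-! ## Conjugation of representations -/

/-- The representation `g ρ g⁻¹`. -/
def conjRep (g : SU2) (ρ : RepSpace) : RepSpace :=
  ⟨(MulAut.conj g).toMonoidHom.comp ρ.1, fun i => by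
    have := re_conj g (ρ.1 (mer i))
    exact this.trans (ρ.2 i)⟩

theorem conjRep_apply (g : SU2) (ρ : RepSpace) (x : SurfaceGroup) :
    (conjRep g ρ).1 x = g * ρ.1 x * g⁻¹ := rfl

theorem cls_conjRep (g : SU2) (ρ : RepSpace) : cls (conjRep g ρ) = cls ρ :=
  (Quotient.sound ⟨g, fun _ => rfl⟩ : cls ρ = cls (conjRep g ρ)).symm

theorem exists_conjRep_of_cls_eq {ρ σ : RepSpace} (h : cls ρ = cls σ) :
    ∃ g, σ = conjRep g ρ := by
  obtain ⟨g, hg⟩ : ∃ g : SU2, ∀ x, σ.1 x = g * ρ.1 x * g⁻¹ := Quotient.exact h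
  exact ⟨g, Subtype.ext (MonoidHom.ext hg)⟩

theorem continuous_conjRep (g : SU2) : Continuous (conjRep g) := by
  refine continuous_of_coords (continuous_pi fun i => ?_)
  have : Continuous fun ρ : RepSpace => (g : ℍ[ℝ]) * coords ρ i * star (g : ℍ[ℝ]) :=
    (continuous_const.mul ((continuous_apply i).comp continuous_coords)).mul continuous_const
  exact this

/-- The inner products of the values on the meridians, as functions on the character variety. -/
def merInner (i j : Fin 4) : CharVar → ℝ :=
  Quotient.lift (fun ρ => killing (coords ρ i) (coords ρ j)) (by
    rintro ρ σ ⟨g, hg⟩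
    have e : ∀ k, coords σ k = Ad g (coords ρ k) := fun k => by
      simp only [coords, hg]; rfl
    simp only [e, killing_Ad])

theorem merInner_cls (i j : Fin 4) (ρ : RepSpace) :
    merInner i j (cls ρ) = killing (coords ρ i) (coords ρ j) := rfl

theorem contDiff_killing {E : Type*} [NormedAddCommGroup E] [NormedSpace ℝ E] {f g : E → ℍ[ℝ]}
    (hf : ContDiff ℝ ∞ f) (hg : ContDiff ℝ ∞ g) : ContDiff ℝ ∞ fun x => killing (f x) (g x) :=
  (contDiff_re.comp (hf.mul hg)).neg

theorem continuous_merInner (i j : Fin 4) : Continuous (merInner i j) := by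
  refine Continuous.quotient_lift ?_ _
  have h : ContDiff ℝ ∞ fun c : Fin 4 → ℍ[ℝ] => killing (c i) (c j) :=
    contDiff_killing (contDiff_apply ℝ _ i) (contDiff_apply ℝ _ j)
  exact h.continuous.comp continuous_coords

/-! ### Inner products of meridians and injectivity of `rhoHat` -/

theorem merInner_torusRep (t : Circle × Circle) :
    merInner 0 1 (cls (torusRep t)) = (t.1 : ℂ).re ∧
    merInner 0 2 (cls (torusRep t)) = (t.2 : ℂ).re ∧
    merInner 1 2 (cls (torusRep t)) =
      (t.1 : ℂ).re * (t.2 : ℂ).re + (t.1 : ℂ).im * (t.2 : ℂ).im := by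
  simp only [merInner_cls, coords_torusRep]
  simp [killing, Quaternion.re_mul, circJ_re, circJ_imI, circJ_imJ, circJ_imK]
  ring

theorem circle_ext {z w : Circle} (hr : (z : ℂ).re = (w : ℂ).re) (hi : (z : ℂ).im = (w : ℂ).im) :
    z = w :=
  Subtype.ext (Complex.ext hr hi)

/-- Equal cosines fix each angle up to sign. The product of the sines makes the two signs agree,
unless a sine vanishes, and then the sign of that angle is immaterial. -/
theorem torus_rel_of_invariants {s t : Circle × Circle} (h₁ : (t.1 : ℂ).re = (s.1 : ℂ).re)
    (h₂ : (t.2 : ℂ).re = (s.2 : ℂ).re)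
    (h₃ : (t.1 : ℂ).im * (t.2 : ℂ).im = (s.1 : ℂ).im * (s.2 : ℂ).im) :
    t = s ∨ t = ellInv s := by
  have re_inv : ∀ z : Circle, ((z⁻¹ : Circle) : ℂ).re = (z : ℂ).re := fun z => by
    simp
  have im_inv : ∀ z : Circle, ((z⁻¹ : Circle) : ℂ).im = -(z : ℂ).im := fun z => by
    simp
  have q : ∀ {z w : Circle}, (z : ℂ).re = (w : ℂ).re →
      (z : ℂ).im = (w : ℂ).im ∨ (z : ℂ).im = -(w : ℂ).im := by
    intro z w h
    have hz := circle_re_im z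
    have hw := circle_re_im w
    rw [h] at hz
    exact mul_self_eq_mul_self_iff.1 (by linarith)
  have same : (t.1 : ℂ).im = (s.1 : ℂ).im → (t.2 : ℂ).im = (s.2 : ℂ).im → t = s :=
    fun a b => Prod.ext (circle_ext h₁ a) (circle_ext h₂ b)
  have opp : (t.1 : ℂ).im = -(s.1 : ℂ).im → (t.2 : ℂ).im = -(s.2 : ℂ).im → t = ellInv s :=
    fun a b => Prod.ext (circle_ext (h₁.trans (re_inv _).symm) (a.trans (im_inv _).symm))
      (circle_ext (h₂.trans (re_inv _).symm) (b.trans (im_inv _).symm))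
  rcases q h₁ with a | a <;> rcases q h₂ with b | b
  · exact Or.inl (same a b)
  · rw [a, b] at h₃
    have h : (s.1 : ℂ).im * (s.2 : ℂ).im = 0 := by linarith
    rcases mul_eq_zero.1 h with h | h
    · exact Or.inr (opp (by rw [a, h, neg_zero]) b)
    · exact Or.inl (same a (by rw [b, h, neg_zero]))
  · rw [a, b] at h₃
    have h : (s.1 : ℂ).im * (s.2 : ℂ).im = 0 := by linarith
    rcases mul_eq_zero.1 h with h | h
    · exact Or.inl (same (by rw [a, h, neg_zero]) b)
    · exact Or.inr (opp a (by rw [b, h, neg_zero]))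
  · exact Or.inr (opp a b)

theorem rhoHat_injective : Function.Injective rhoHat := by
  intro p q
  induction p using Quotient.inductionOn with
  | h s =>
  induction q using Quotient.inductionOn with
  | h t =>
    intro h
    rw [rhoHat_mk, rhoHat_mk] at h
    obtain ⟨a₁, a₂, a₃⟩ := merInner_torusRep s
    obtain ⟨b₁, b₂, b₃⟩ := merInner_torusRep t
    rw [h] at a₁ a₂ a₃
    have h₁ := b₁.symm.trans a₁
    have h₂ := b₂.symm.trans a₂
    have h₃ := b₃.symm.trans a₃
    rw [h₁, h₂] at h₃
    exact Quotient.sound (torus_rel_of_invariants h₁ h₂ (by linarith))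

/-! ## Every representation is conjugate into the torus -/

theorem normSq_su2 (g : SU2) : (g : ℍ[ℝ]).re ^ 2 + (g : ℍ[ℝ]).imI ^ 2 + (g : ℍ[ℝ]).imJ ^ 2
    + (g : ℍ[ℝ]).imK ^ 2 = 1 := by
  have h := Unitary.coe_star_mul_self g
  rw [Quaternion.star_mul_self] at h
  have := congrArg (fun q : ℍ[ℝ] => q.re) h
  simp only [Quaternion.re_coe, Quaternion.re_one] at this
  exact (Quaternion.normSq_def' _).symm.trans this

/-- A nonzero intertwiner can be rescaled to a unit quaternion. The scalar is kept so that further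
properties of q, such as what it commutes with, pass to g. -/
theorem exists_conj_of_mul {P Q : SU2} (q : ℍ[ℝ]) (hq : q ≠ 0)
    (h : q * (P : ℍ[ℝ]) = (Q : ℍ[ℝ]) * q) :
    ∃ (g : SU2) (r : ℝ), (g : ℍ[ℝ]) = r • q ∧ g * P * g⁻¹ = Q := by
  have hn : 0 < Quaternion.normSq q := lt_of_le_of_ne Quaternion.normSq_nonneg
    (Ne.symm (Quaternion.normSq_ne_zero.2 hq))
  let r := (Real.sqrt (Quaternion.normSq q))⁻¹
  have hr : r ^ 2 * Quaternion.normSq q = 1 := by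
    simp only [r, inv_pow, Real.sq_sqrt hn.le]
    exact inv_mul_cancel₀ hn.ne'
  refine ⟨⟨r • q, mem_unitary_of_normSq (by rw [Quaternion.normSq_smul, hr])⟩, r, rfl, ?_⟩
  rw [mul_inv_eq_iff_eq_mul]
  apply Subtype.ext
  change (r • q) * (P : ℍ[ℝ]) = (Q : ℍ[ℝ]) * (r • q)
  rw [smul_mul_assoc, h, mul_smul_comm]

/-- The unit quaternion `i`. -/
def unitI : SU2 := ⟨quat 0 1 0 0, mem_unitary_of_normSq (by rw [Quaternion.normSq_def']; simp)⟩

theorem circJ_one_coe : (circJ 1 : ℍ[ℝ]) = quatJ := by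
  ext <;> simp [circJ_re, circJ_imI, circJ_imJ, circJ_imK, quatJ_re, quatJ_imI, quatJ_imJ,
    quatJ_imK]

theorem exists_conj_circJ_one {P : SU2} (hP : (P : ℍ[ℝ]).re = 0) :
    ∃ g : SU2, g * P * g⁻¹ = circJ 1 := by
  have hn := normSq_su2 P
  by_cases h : (P : ℍ[ℝ]).imJ = -1
  -- Here P = -j, where the intertwiner of the other case vanishes; conjugation by i takes -j to j.
  · have h2 : (P : ℍ[ℝ]).imI = 0 := by nlinarith
    have h3 : (P : ℍ[ℝ]).imK = 0 := by nlinarith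
    refine ⟨unitI, ?_⟩
    rw [mul_inv_eq_iff_eq_mul]
    apply Subtype.ext
    change quat 0 1 0 0 * (P : ℍ[ℝ]) = (circJ 1 : ℍ[ℝ]) * quat 0 1 0 0
    rw [circJ_one_coe]
    ext <;> simp [Quaternion.re_mul, Quaternion.imI_mul, Quaternion.imJ_mul, Quaternion.imK_mul,
      quatJ_re, quatJ_imI, quatJ_imJ, quatJ_imK, hP, h, h2, h3]
  -- Since P² = j² = -1, both (1 - jP)P and j(1 - jP) equal P + j.
  · obtain ⟨g, -, -, hg⟩ := exists_conj_of_mul (P := P) (Q := circJ 1) (1 - quatJ * (P : ℍ[ℝ]))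
      (fun h0 => h (by
        have := congrArg (fun q : ℍ[ℝ] => q.re) h0
        simp [Quaternion.re_mul, quatJ_re, quatJ_imI, quatJ_imJ, quatJ_imK] at this
        linarith))
      (by
        rw [circJ_one_coe]
        ext <;> simp [Quaternion.re_mul, Quaternion.imI_mul, Quaternion.imJ_mul,
          Quaternion.imK_mul, quatJ_re, quatJ_imI, quatJ_imJ, quatJ_imK, hP]
        all_goals simp only [hP] at hn
        all_goals first | ring1 | linear_combination hn)
    exact ⟨g, hg⟩

theorem exists_conj_unitI {P : SU2} (hP : (P : ℍ[ℝ]).re = 0) (hJ : (P : ℍ[ℝ]).imJ = 0) :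
    ∃ g : SU2, g * P * g⁻¹ = unitI ∧ g * circJ 1 * g⁻¹ = circJ 1 := by
  have hn := normSq_su2 P
  by_cases h : (P : ℍ[ℝ]).imI = -1
  · have h3 : (P : ℍ[ℝ]).imK = 0 := by nlinarith
    refine ⟨circJ 1, ?_, by simp⟩
    rw [mul_inv_eq_iff_eq_mul]
    apply Subtype.ext
    change (circJ 1 : ℍ[ℝ]) * (P : ℍ[ℝ]) = quat 0 1 0 0 * (circJ 1 : ℍ[ℝ])
    rw [circJ_one_coe]
    ext <;> simp [Quaternion.re_mul, Quaternion.imI_mul, Quaternion.imJ_mul, Quaternion.imK_mul,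
      quatJ_re, quatJ_imI, quatJ_imJ, quatJ_imK, hP, h, hJ, h3]
  -- The quaternion is 1 - iP, an intertwiner of P and i for the same reason. As P has no
  -- j-component, it lies in the span of 1 and j and so commutes with j.
  · obtain ⟨g, r, hr, hg⟩ := exists_conj_of_mul (P := P) (Q := unitI)
      (quat (1 + (P : ℍ[ℝ]).imI) 0 (P : ℍ[ℝ]).imK 0)
      (fun h0 => h (by
        have := congrArg (fun q : ℍ[ℝ] => q.re) h0
        simp at this
        linarith))
      (by
        change _ = quat 0 1 0 0 * _
        ext <;> simp [Quaternion.re_mul, Quaternion.imI_mul, Quaternion.imJ_mul,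
          Quaternion.imK_mul, hP, hJ] <;> nlinarith)
    refine ⟨g, hg, ?_⟩
    rw [mul_inv_eq_iff_eq_mul]
    apply Subtype.ext
    change (g : ℍ[ℝ]) * (circJ 1 : ℍ[ℝ]) = (circJ 1 : ℍ[ℝ]) * (g : ℍ[ℝ])
    rw [hr, circJ_one_coe]
    ext <;> simp [Quaternion.re_mul, Quaternion.imI_mul, Quaternion.imJ_mul, Quaternion.imK_mul,
      quatJ_re, quatJ_imI, quatJ_imJ, quatJ_imK]

theorem exists_circle {x y : ℝ} (h : x ^ 2 + y ^ 2 = 1) :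
    ∃ z : Circle, (z : ℂ).re = x ∧ (z : ℂ).im = y := by
  refine ⟨⟨⟨x, y⟩, mem_sphere_zero_iff_norm.2 ?_⟩, rfl, rfl⟩
  rw [← sq_eq_sq₀ (norm_nonneg _) zero_le_one, ← Complex.normSq_eq_norm_sq, Complex.normSq_apply]
  linarith

theorem exists_circJ_eq {P : SU2} (hP : (P : ℍ[ℝ]).re = 0) (hI : (P : ℍ[ℝ]).imI = 0) :
    ∃ z, P = circJ z := by
  have hn := normSq_su2 P
  rw [hP, hI] at hn
  obtain ⟨z, hr, hi⟩ := exists_circle (x := (P : ℍ[ℝ]).imJ) (y := (P : ℍ[ℝ]).imK) (by linarith)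
  exact ⟨z, su2_ext (hP.trans (circJ_re z).symm) (hI.trans (circJ_imI z).symm)
    (hr.symm.trans (circJ_imJ z).symm) (hi.symm.trans (circJ_imK z).symm)⟩

theorem killing_eq {v w : ℍ[ℝ]} (hv : v.re = 0) :
    killing v w = v.imI * w.imI + v.imJ * w.imJ + v.imK * w.imK := by
  simp only [killing, Quaternion.re_mul, hv]; ring

/-- Three traceless matrices with traceless product lie in a plane. -/
theorem exists_common_normal {A B C : SU2} (hA : (A : ℍ[ℝ]).re = 0) (hB : (B : ℍ[ℝ]).re = 0)
    (hC : (C : ℍ[ℝ]).re = 0) (h : ((A * B * C : SU2) : ℍ[ℝ]).re = 0) :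
    ∃ N : SU2, (N : ℍ[ℝ]).re = 0 ∧ killing N A = 0 ∧ killing N B = 0 ∧ killing N C = 0 := by
  let M : Matrix (Fin 3) (Fin 3) ℝ := !![(A : ℍ[ℝ]).imI, (A : ℍ[ℝ]).imJ, (A : ℍ[ℝ]).imK;
    (B : ℍ[ℝ]).imI, (B : ℍ[ℝ]).imJ, (B : ℍ[ℝ]).imK;
    (C : ℍ[ℝ]).imI, (C : ℍ[ℝ]).imJ, (C : ℍ[ℝ]).imK]
  -- Up to sign, the determinant is the real part of ABC.
  have hM : M.det = 0 := by
    simp only [Submonoid.coe_mul, Quaternion.re_mul, Quaternion.imI_mul, Quaternion.imJ_mul,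
      Quaternion.imK_mul, hA, hB, hC] at h
    rw [Matrix.det_fin_three]
    simp [M]
    linarith
  obtain ⟨v, hv, hMv⟩ := Matrix.exists_mulVec_eq_zero_iff.2 hM
  let q : ℍ[ℝ] := quat 0 (v 0) (v 1) (v 2)
  have hq : q ≠ 0 := by
    intro h0
    apply hv
    have h1 := congrArg (fun q : ℍ[ℝ] => q.imI) h0
    have h2 := congrArg (fun q : ℍ[ℝ] => q.imJ) h0
    have h3 := congrArg (fun q : ℍ[ℝ] => q.imK) h0
    simp only [q] at h1 h2 h3
    ext i; fin_cases i
    · exact h1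
    · exact h2
    · exact h3
  -- Used only to normalize q to unit length.
  obtain ⟨g, r, hg, -⟩ := exists_conj_of_mul (P := 1) (Q := 1) q hq (by simp)
  have e0 := congrFun hMv 0
  have e1 := congrFun hMv 1
  have e2 := congrFun hMv 2
  simp [M, Matrix.mulVec, dotProduct, Fin.sum_univ_three] at e0 e1 e2
  have hre : q.re = 0 := rfl
  refine ⟨g, by rw [hg]; simp [hre], ?_, ?_, ?_⟩
  · rw [hg, killing_smul_left, killing_eq hre, mul_eq_zero]
    right; simp only [q, quat_imI, quat_imJ, quat_imK]; linarith
  · rw [hg, killing_smul_left, killing_eq hre, mul_eq_zero]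
    right; simp only [q, quat_imI, quat_imJ, quat_imK]; linarith
  · rw [hg, killing_smul_left, killing_eq hre, mul_eq_zero]
    right; simp only [q, quat_imI, quat_imJ, quat_imK]; linarith

theorem exists_conjRep_eq_torusRep (ρ : RepSpace) : ∃ g t, conjRep g ρ = torusRep t := by
  have hD : ((ρ.1 (mer 0) * ρ.1 (mer 1) * ρ.1 (mer 2) : SU2) : ℍ[ℝ]).re = 0 := by
    have h : ρ.1 (mer 0) * ρ.1 (mer 1) * ρ.1 (mer 2) = (ρ.1 (mer 3))⁻¹ := by
      rw [eq_inv_iff_mul_eq_one, ← map_mul, ← map_mul, ← map_mul, mer_rel, map_one]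
    rw [h, coe_inv_su2, Quaternion.re_star]
    exact ρ.2 3
  obtain ⟨N, hN, hA, hB, hC⟩ := exists_common_normal (ρ.2 0) (ρ.2 1) (ρ.2 2) hD
  obtain ⟨g, hg⟩ := exists_conj_circJ_one (ρ.2 0)
  have hN' : ((g * N * g⁻¹ : SU2) : ℍ[ℝ]).re = 0 := by rw [re_conj, hN]
  -- N is orthogonal to A, which now sits at j; hence a rotation about j can take N to i without
  -- moving A.
  have hNJ : ((g * N * g⁻¹ : SU2) : ℍ[ℝ]).imJ = 0 := by
    have h : killing (Ad g N) (Ad g (ρ.1 (mer 0) : SU2)) = 0 := by rw [killing_Ad, hA]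
    have e : Ad g (ρ.1 (mer 0) : SU2) = quatJ := by
      rw [← circJ_one_coe, ← hg]; rfl
    have e' : Ad g N = ((g * N * g⁻¹ : SU2) : ℍ[ℝ]) := rfl
    rw [e, e', killing_eq hN'] at h
    simp only [quatJ_imI, quatJ_imJ, quatJ_imK] at h
    linarith
  obtain ⟨k, hk, hk'⟩ := exists_conj_unitI hN' hNJ
  -- A traceless element orthogonal to i has only j- and k-components, so it is e^{iθ}j.
  have key : ∀ i, killing N (ρ.1 (mer i) : SU2) = 0 →
      ∃ z, (conjRep (k * g) ρ).1 (mer i) = circJ z := by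
    intro i hi
    refine exists_circJ_eq ((conjRep (k * g) ρ).2 i) ?_
    have h : killing (Ad (k * g) N) (Ad (k * g) (ρ.1 (mer i) : SU2)) = 0 := by rw [killing_Ad, hi]
    have e : Ad (k * g) N = quat 0 1 0 0 := by
      have : k * g * N * (k * g)⁻¹ = unitI := by rw [← hk]; group
      exact congrArg Subtype.val this
    rw [e, killing_eq (quat_re _ _ _ _)] at h
    have e' : Ad (k * g) (ρ.1 (mer i) : SU2) = ((conjRep (k * g) ρ).1 (mer i) : SU2) := rfl
    rw [e'] at h
    simpa using h
  obtain ⟨z, hz⟩ := key 1 hB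
  obtain ⟨w, hw⟩ := key 2 hC
  have h0 : (conjRep (k * g) ρ).1 (mer 0) = circJ 1 := by
    rw [conjRep_apply]
    have : k * g * ρ.1 (mer 0) * (k * g)⁻¹ = k * (g * ρ.1 (mer 0) * g⁻¹) * k⁻¹ := by group
    rw [this, hg, hk']
  refine ⟨k * g, (z, w), Subtype.ext (hom_ext_mer fun i => ?_)⟩
  have ht : ∀ i, (torusRep (z, w)).1 (mer i) = ![circJ 1, circJ z, circJ w, circJ (w * z⁻¹)] i :=
    fun i => homOfMer_mer _ _ _ _ (circJ_rel z w) i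
  have hi : i = 0 ∨ i = 1 ∨ i = 2 ∨ i = 3 := by fin_cases i <;> simp
  have t0 : (torusRep (z, w)).1 (mer 0) = circJ 1 := ht 0
  have t1 : (torusRep (z, w)).1 (mer 1) = circJ z := ht 1
  have t2 : (torusRep (z, w)).1 (mer 2) = circJ w := ht 2
  rcases hi with rfl | rfl | rfl | rfl
  · rw [h0, t0]
  · rw [hz, t1]
  · rw [hw, t2]
  · rw [mer_three, map_mul, map_mul, map_inv, map_inv, map_inv, h0, hz, hw,
      map_mul, map_mul, map_inv, map_inv, map_inv, t0, t1, t2]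

theorem exists_cls_eq_torusRep (x : CharVar) : ∃ t, x = cls (torusRep t) := by
  induction x using Quotient.inductionOn with
  | h ρ =>
    obtain ⟨g, t, h⟩ := exists_conjRep_eq_torusRep ρ
    exact ⟨t, by rw [← h, cls_conjRep]; rfl⟩

theorem rhoHat_surjective : Function.Surjective rhoHat := by
  intro x
  obtain ⟨t, rfl⟩ := exists_cls_eq_torusRep x
  exact ⟨Quotient.mk torusSetoid t, rfl⟩

/-! ### Hausdorffness and the homeomorphism -/

instance : T2Space CharVar := by
  refine T2Space.of_injective_continuous
    (f := fun x => (merInner 0 1 x, merInner 0 2 x, merInner 1 2 x)) ?_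
    ((continuous_merInner 0 1).prodMk ((continuous_merInner 0 2).prodMk (continuous_merInner 1 2)))
  intro x y h
  obtain ⟨s, rfl⟩ := exists_cls_eq_torusRep x
  obtain ⟨t, rfl⟩ := exists_cls_eq_torusRep y
  simp only [Prod.mk.injEq] at h
  obtain ⟨a₁, a₂, a₃⟩ := merInner_torusRep s
  obtain ⟨b₁, b₂, b₃⟩ := merInner_torusRep t
  rw [a₁, a₂, a₃, b₁, b₂, b₃] at h
  obtain ⟨h₁, h₂, h₃⟩ := h
  rw [h₁, h₂] at h₃
  have : (Quotient.mk torusSetoid t) = Quotient.mk torusSetoid s :=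
    Quotient.sound (torus_rel_of_invariants h₁ h₂ (by linarith))
  rw [← rhoHat_mk, ← rhoHat_mk, this]

theorem isHomeomorph_rhoHat : IsHomeomorph rhoHat :=
  isHomeomorph_iff_continuous_bijective.2
    ⟨continuous_rhoHat, rhoHat_injective, rhoHat_surjective⟩

/-! ## The action of `PSL(2, ℤ)` -/

theorem continuous_slTorus (A : SL(2, ℤ)) : Continuous (slTorus A) :=
  ((continuous_fst.zpow _).mul (continuous_snd.zpow _)).prodMk
    ((continuous_fst.zpow _).mul (continuous_snd.zpow _))

theorem pslPillow_coe (A : SL(2, ℤ)) (t : Circle × Circle) :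
    pslPillow (QuotientGroup.mk A) (Quotient.mk torusSetoid t) =
      Quotient.mk torusSetoid (slTorus A t) := rfl

theorem continuous_pslPillow (g : PSL2Z) : Continuous (pslPillow g) := by
  induction g using QuotientGroup.induction_on with
  | H A =>
    refine continuous_quot_lift _ ?_
    exact continuous_quotient_mk'.comp (continuous_slTorus A)

/-- The pillowcase and the character variety are homeomorphic. -/
def rhoHomeo : Pillow ≃ₜ CharVar := isHomeomorph_rhoHat.homeomorph

/-- The action of `PSL(2, ℤ)` on the pillowcase by homeomorphisms. -/
def pslHomeo : PSL2Z →* (Pillow ≃ₜ Pillow) where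
  toFun g :=
    { toEquiv := pslPillow g
      continuous_toFun := continuous_pslPillow g
      continuous_invFun := by
        have h : (pslPillow g).symm = pslPillow g⁻¹ := by rw [map_inv]; rfl
        change Continuous (pslPillow g).symm
        rw [h]
        exact continuous_pslPillow g⁻¹ }
  map_one' := by
    ext p
    change pslPillow 1 p = p
    rw [map_one]; rfl
  map_mul' g h := by
    ext p
    change pslPillow (g * h) p = pslPillow g (pslPillow h p)
    rw [map_mul]; rfl

/-- The action of `PSL(2, ℤ)` on the character variety, transported from the pillowcase. -/
def pslCharVar : PSL2Z →* (CharVar ≃ₜ CharVar) where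
  toFun g := (rhoHomeo.symm.trans (pslHomeo g)).trans rhoHomeo
  map_one' := by
    ext x
    change rhoHomeo (pslHomeo 1 (rhoHomeo.symm x)) = x
    rw [map_one]
    exact rhoHomeo.apply_symm_apply x
  map_mul' g h := by
    ext x
    change rhoHomeo (pslHomeo (g * h) (rhoHomeo.symm x)) =
      rhoHomeo (pslHomeo g (rhoHomeo.symm (rhoHomeo (pslHomeo h (rhoHomeo.symm x)))))
    rw [map_mul, Homeomorph.symm_apply_apply]
    rfl

theorem pslCharVar_rhoHat (g : PSL2Z) (p : Pillow) :
    pslCharVar g (rhoHat p) = rhoHat (pslPillow g p) := by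
  change rhoHomeo (pslHomeo g (rhoHomeo.symm (rhoHomeo p))) = _
  rw [Homeomorph.symm_apply_apply]
  rfl

theorem ext_of_rhoHat {Ψ Ψ' : CharVar ≃ₜ CharVar} (h : ∀ p, Ψ (rhoHat p) = Ψ' (rhoHat p)) :
    Ψ = Ψ' := by
  ext x
  obtain ⟨p, rfl⟩ := rhoHat_surjective x
  exact h p

/-! ### Faithfulness -/

/-- By irrationality of π, e^i has infinite order, so equal powers have equal exponents. Testing A
on the point (e^{iu}, e^{iv}) then shows that it fixes the integer vector (u, v) up to sign. -/
theorem slPillow_eq_one_entries {A : SL(2, ℤ)} (h : slPillow A = 1) (u v : ℤ) :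
    (A 0 0 * u + A 0 1 * v = u ∧ A 1 0 * u + A 1 1 * v = v) ∨
    (A 0 0 * u + A 0 1 * v = -u ∧ A 1 0 * u + A 1 1 * v = -v) := by
  have exp_int : ∀ m : ℤ, Circle.exp (m : ℝ) = Circle.exp 1 ^ m := fun m => by
    rw [← Circle.exp_zsmul, zsmul_eq_mul, mul_one]
  have inj : ∀ m n : ℤ, Circle.exp 1 ^ m = Circle.exp 1 ^ n → m = n := by
    intro m n hmn
    rw [← exp_int, ← exp_int, Circle.exp_eq_exp] at hmn
    obtain ⟨k, hk⟩ := hmn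
    by_cases hk0 : k = 0
    · subst hk0
      have : (m : ℝ) = n := by simpa using hk
      exact_mod_cast this
    · exfalso
      apply irrational_pi
      refine ⟨(m - n : ℚ) / (2 * k), ?_⟩
      have hk0' : (k : ℝ) ≠ 0 := by exact_mod_cast hk0
      push_cast
      rw [div_eq_iff (by positivity)]
      linarith
  have e : slPillow A (Quotient.mk torusSetoid (Circle.exp 1 ^ u, Circle.exp 1 ^ v)) =
      Quotient.mk torusSetoid (Circle.exp 1 ^ u, Circle.exp 1 ^ v) := by rw [h]; rfl
  rw [slPillow_mk] at e
  have r : (Circle.exp 1 ^ u, Circle.exp 1 ^ v) =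
        slTorus A (Circle.exp 1 ^ u, Circle.exp 1 ^ v) ∨
      (Circle.exp 1 ^ u, Circle.exp 1 ^ v) =
        ellInv (slTorus A (Circle.exp 1 ^ u, Circle.exp 1 ^ v)) := Quotient.exact e
  simp only [slTorus, ellInv, ← zpow_mul, ← zpow_add, ← zpow_neg, Prod.mk.injEq] at r
  rcases r with ⟨r₁, r₂⟩ | ⟨r₁, r₂⟩
  · left
    have h₁ := inj _ _ r₁
    have h₂ := inj _ _ r₂
    constructor <;> linarith
  · right
    have h₁ := inj _ _ r₁
    have h₂ := inj _ _ r₂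
    constructor <;> linarith

theorem mem_center_of_slPillow_eq_one {A : SL(2, ℤ)} (h : slPillow A = 1) :
    A ∈ Subgroup.center SL(2, ℤ) := by
  have h₁ := slPillow_eq_one_entries h 1 0
  have h₂ := slPillow_eq_one_entries h 0 1
  -- The vector (1, 1) forces the signs at the two basis vectors to agree.
  have h₃ := slPillow_eq_one_entries h 1 1
  simp only [mul_one, mul_zero, add_zero, zero_add, neg_zero] at h₁ h₂ h₃
  have key : A 0 1 = 0 ∧ A 1 0 = 0 ∧ A 0 0 = A 1 1 := by omega
  obtain ⟨k₁, k₂, k₃⟩ := key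
  rw [Matrix.SpecialLinearGroup.mem_center_iff]
  refine ⟨A 0 0, by
    simp only [Fintype.card_fin]
    rcases h₁ with h₁ | h₁ <;> rw [h₁.1] <;> norm_num, ?_⟩
  ext i j
  rw [Matrix.scalar_apply]
  fin_cases i <;> fin_cases j <;> simp [k₁, k₂, k₃]

theorem pslCharVar_injective : Function.Injective pslCharVar := by
  rw [injective_iff_map_eq_one]
  intro g
  induction g using QuotientGroup.induction_on with
  | H A =>
    intro h
    have hA : slPillow A = 1 := by
      ext p
      apply rhoHat_injective
      have := pslCharVar_rhoHat (QuotientGroup.mk A) p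
      rw [h] at this
      exact this.symm
    exact (QuotientGroup.eq_one_iff A).2 (mem_center_of_slPillow_eq_one hA)

/-! ### The half twists generate -/

theorem repSpace_ext {ρ σ : RepSpace} (h₀ : ρ.1 (mer 0) = σ.1 (mer 0))
    (h₁ : ρ.1 (mer 1) = σ.1 (mer 1)) (h₂ : ρ.1 (mer 2) = σ.1 (mer 2)) : ρ = σ := by
  refine Subtype.ext (hom_ext_mer fun i => ?_)
  fin_cases i
  · exact h₀
  · exact h₁
  · exact h₂
  · change ρ.1 (mer 3) = σ.1 (mer 3)
    simp only [mer_three, map_mul, map_inv, h₀, h₁, h₂]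

theorem torusRep_mer (t : Circle × Circle) (i : Fin 4) :
    (torusRep t).1 (mer i) = ![circJ 1, circJ t.1, circJ t.2, circJ (t.2 * t.1⁻¹)] i :=
  homOfMer_mer _ _ _ _ (circJ_rel t.1 t.2) i

/-- The matrix of the half twist in the first disk. -/
def slTwist₁ : SL(2, ℤ) := ⟨!![1, 0; -1, 1], by simp [Matrix.det_fin_two]⟩

/-- The matrix of the half twist in the second disk. -/
def slTwist₂ : SL(2, ℤ) := ⟨!![1, 1; 0, 1], by simp [Matrix.det_fin_two]⟩

/-- The meridian d goes to e^{i(y-x)}j, so replacing c by d changes (x, y) to (x, y - x). -/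
theorem pullRep_torusRep₁ (t : Circle × Circle) :
    pullRep ⟨halfTwist₁, halfTwist₁_mem⟩ (torusRep t) = torusRep (slTorus slTwist₁ t) := by
  have hm : ∀ i, (pullRep ⟨halfTwist₁, halfTwist₁_mem⟩ (torusRep t)).1 (mer i) =
      (torusRep t).1 (halfTwist₁ (mer i)) := fun i => rfl
  apply repSpace_ext
  · rw [hm, halfTwist₁_mer, torusRep_mer]
    exact torusRep_mer t 0
  · rw [hm, halfTwist₁_mer, torusRep_mer]
    refine (torusRep_mer t 1).trans ?_
    simp [slTorus, slTwist₁]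
  · rw [hm, halfTwist₁_mer, torusRep_mer, ← mer_three]
    refine (torusRep_mer t 3).trans ?_
    simp [slTorus, slTwist₁, mul_comm]

/-- Conjugation by e^{iθ}j is the half turn about that axis; it reflects the circle of the elements
e^{iφ}j, sending φ to 2θ - φ. -/
theorem circJ_conj_circJ (z w : Circle) :
    circJ w * circJ z * (circJ w)⁻¹ = circJ (w * w * z⁻¹) := by
  have hw := circle_re_im w
  rw [mul_inv_eq_iff_eq_mul]
  apply Subtype.ext
  change (circJ w : ℍ[ℝ]) * circJ z = (circJ (w * w * z⁻¹) : ℍ[ℝ]) * circJ w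
  ext <;> simp only [Quaternion.re_mul, Quaternion.imI_mul, Quaternion.imJ_mul,
      Quaternion.imK_mul, circJ_re, circJ_imI, circJ_imJ, circJ_imK, Circle.coe_mul,
      Circle.coe_inv_eq_conj, Complex.mul_re, Complex.mul_im, Complex.conj_re, Complex.conj_im]
  · linear_combination ((w : ℂ).re * (z : ℂ).re + (w : ℂ).im * (z : ℂ).im) * hw
  · linear_combination ((w : ℂ).im * (z : ℂ).re - (w : ℂ).re * (z : ℂ).im) * hw
  · ring
  · ring

theorem pullRep_torusRep₂ (t : Circle × Circle) :
    pullRep ⟨halfTwist₂, halfTwist₂_mem⟩ (torusRep t) = torusRep (slTorus slTwist₂ t) := by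
  have hm : ∀ i, (pullRep ⟨halfTwist₂, halfTwist₂_mem⟩ (torusRep t)).1 (mer i) =
      (torusRep t).1 (halfTwist₂ (mer i)) := fun i => rfl
  apply repSpace_ext
  · rw [hm, halfTwist₂_mer, torusRep_mer]
    exact torusRep_mer t 0
  · have e : (mer 1)⁻¹ * (mer 0)⁻¹ * (mer 2)⁻¹ = mer 2 * mer 3 * (mer 2)⁻¹ := by
      rw [mer_three]; group
    rw [hm, halfTwist₂_mer, torusRep_mer]
    change (torusRep t).1 ((mer 1)⁻¹ * (mer 0)⁻¹ * (mer 2)⁻¹) = _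
    rw [e, map_mul, map_mul, map_inv, torusRep_mer, torusRep_mer]
    refine (circJ_conj_circJ (t.2 * t.1⁻¹) t.2).trans ?_
    refine congrArg circJ ?_
    -- In angles: 2y - (y - x) = x + y.
    change t.2 * t.2 * (t.2 * t.1⁻¹)⁻¹ = t.1 ^ (1 : ℤ) * t.2 ^ (1 : ℤ)
    rw [zpow_one, zpow_one, mul_inv_eq_iff_eq_mul, mul_comm t.2 t.1⁻¹, mul_mul_mul_comm,
      mul_inv_cancel, one_mul]
  · rw [hm, halfTwist₂_mer, torusRep_mer]
    refine (torusRep_mer t 2).trans ?_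
    simp [slTorus, slTwist₂]

theorem pslCharVar_slTwist₁ : pslCharVar (QuotientGroup.mk slTwist₁) = twistAction₁ := by
  refine ext_of_rhoHat fun p => ?_
  induction p using Quotient.inductionOn with
  | h t =>
    rw [pslCharVar_rhoHat, pslPillow_coe, rhoHat_mk, rhoHat_mk, ← pullRep_torusRep₁]
    rfl

theorem pslCharVar_slTwist₂ : pslCharVar (QuotientGroup.mk slTwist₂) = twistAction₂ := by
  refine ext_of_rhoHat fun p => ?_
  induction p using Quotient.inductionOn with
  | h t =>
    rw [pslCharVar_rhoHat, pslPillow_coe, rhoHat_mk, rhoHat_mk, ← pullRep_torusRep₂]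
    rfl

theorem closure_slTwist : Subgroup.closure {slTwist₁, slTwist₂} = (⊤ : Subgroup SL(2, ℤ)) := by
  rw [eq_top_iff, ← SpecialLinearGroup.SL2Z_generators, Subgroup.closure_le]
  have h₁ : slTwist₁ ∈ Subgroup.closure {slTwist₁, slTwist₂} :=
    Subgroup.subset_closure (by simp)
  have h₂ : slTwist₂ ∈ Subgroup.closure {slTwist₁, slTwist₂} :=
    Subgroup.subset_closure (by simp)
  -- The braid word in the two unipotent matrices is a quarter turn.
  have hS : ModularGroup.S = (slTwist₂ * slTwist₁ * slTwist₂)⁻¹ := by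
    rw [eq_inv_iff_mul_eq_one]
    exact Subtype.ext (by decide)
  have hT : ModularGroup.T = slTwist₂ := rfl
  rintro x (rfl | rfl)
  · rw [hS]
    exact inv_mem (mul_mem (mul_mem h₂ h₁) h₂)
  · rw [hT]
    exact h₂

theorem range_pslCharVar :
    pslCharVar.range = Subgroup.closure {twistAction₁, twistAction₂} := by
  let π : SL(2, ℤ) →* PSL2Z := QuotientGroup.mk' (Subgroup.center SL(2, ℤ))
  have hπ : Function.Surjective π := QuotientGroup.mk'_surjective _
  have h : (pslCharVar.comp π).range = pslCharVar.range := by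
    rw [MonoidHom.range_comp, MonoidHom.range_eq_top.2 hπ, ← MonoidHom.range_eq_map]
  rw [← h, MonoidHom.range_eq_map, ← closure_slTwist, MonoidHom.map_closure, Set.image_pair]
  have e₁ : (pslCharVar.comp π) slTwist₁ = twistAction₁ := pslCharVar_slTwist₁
  have e₂ : (pslCharVar.comp π) slTwist₂ = twistAction₂ := pslCharVar_slTwist₂
  rw [e₁, e₂]

/-! ## Cocycles and cup products -/

theorem Ad_one (v : ℍ[ℝ]) : Ad 1 v = v := by simp [Ad]

theorem Ad_inv_Ad (g : SU2) (v : ℍ[ℝ]) : Ad g⁻¹ (Ad g v) = v := by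
  rw [← Ad_mul, inv_mul_cancel, Ad_one]

theorem Ad_Ad_inv (g : SU2) (v : ℍ[ℝ]) : Ad g (Ad g⁻¹ v) = v := by
  rw [← Ad_mul, mul_inv_cancel, Ad_one]

theorem Ad_mem_su2 (g : SU2) {v : ℍ[ℝ]} (hv : v ∈ su2) : Ad g v ∈ su2 := by
  change ((g : ℍ[ℝ]) * v * star (g : ℍ[ℝ])).re = 0
  rw [re_mul_comm, ← mul_assoc, Unitary.coe_star_mul_self, one_mul]
  exact hv

theorem cocycle_one {ρ : RepSpace} {z : SurfaceGroup → ℍ[ℝ]} (hz : z ∈ Cocycle ρ) : z 1 = 0 := by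
  have h := hz.2 1 1
  rw [map_one, Ad_one, mul_one] at h
  exact left_eq_add.1 h

theorem cocycle_inv {ρ : RepSpace} {z : SurfaceGroup → ℍ[ℝ]} (hz : z ∈ Cocycle ρ)
    (g : SurfaceGroup) : z g⁻¹ = -Ad (ρ.1 g)⁻¹ (z g) := by
  have h := hz.2 g⁻¹ g
  rw [inv_mul_cancel, cocycle_one hz, map_inv] at h
  exact eq_neg_of_add_eq_zero_left h.symm

/-- A cochain which bounds on a loop bounds on all conjugates of the loop. -/
theorem cocycle_conj {ρ : RepSpace} {z : SurfaceGroup → ℍ[ℝ]} (hz : z ∈ Cocycle ρ)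
    (g m : SurfaceGroup) {ξ : ℍ[ℝ]} (hm : z m = Ad (ρ.1 m) ξ - ξ) :
    z (g * m * g⁻¹) = Ad (ρ.1 (g * m * g⁻¹)) (Ad (ρ.1 g) ξ - z g) - (Ad (ρ.1 g) ξ - z g) := by
  have e : Ad (ρ.1 (g * m * g⁻¹)) (Ad (ρ.1 g) ξ) = Ad (ρ.1 g) (Ad (ρ.1 m) ξ) := by
    rw [← Ad_mul, ← Ad_mul, ← map_mul, ← map_mul, inv_mul_cancel_right]
  have e' : Ad (ρ.1 (g * m)) (z g⁻¹) = -Ad (ρ.1 (g * m * g⁻¹)) (z g) := by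
    rw [cocycle_inv hz, map_neg, ← Ad_mul, map_mul _ (g * m) g⁻¹, map_inv]
  rw [hz.2 (g * m) g⁻¹, hz.2 g m, e', map_sub, e, hm, map_sub]
  abel

/-- The cup product of two cochains, with coefficients paired by `{ , }`. -/
def cup (ρ : RepSpace) (z w : SurfaceGroup → ℍ[ℝ]) (g h : SurfaceGroup) : ℝ :=
  killing (z g) (Ad (ρ.1 g) (w h))

/-- By `Ad`-invariance of the pairing, a cup product of cocycles is a 2-cocycle. This is what allows
the fundamental chain to be re-bracketed. -/
theorem cup_cocycle {ρ : RepSpace} {z w : SurfaceGroup → ℍ[ℝ]} (hz : z ∈ Cocycle ρ)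
    (hw : w ∈ Cocycle ρ) (g h k : SurfaceGroup) :
    cup ρ z w g h + cup ρ z w (g * h) k = cup ρ z w h k + cup ρ z w g (h * k) := by
  simp only [cup, hz.2 g h, hw.2 h k, map_mul, map_add, killing_add_left, killing_add_right,
    Ad_mul, killing_Ad]
  ring

theorem killing_neg_left (v w : ℍ[ℝ]) : killing (-v) w = -killing v w := by
  simp [killing]

theorem killing_neg_right (v w : ℍ[ℝ]) : killing v (-w) = -killing v w := by
  simp [killing]

theorem cup_self_inv {ρ : RepSpace} {z w : SurfaceGroup → ℍ[ℝ]}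
    (hw : w ∈ Cocycle ρ) (g : SurfaceGroup) : cup ρ z w g g⁻¹ = -killing (z g) (w g) := by
  rw [cup, cocycle_inv hw, map_neg, Ad_Ad_inv, killing_neg_right]

theorem cup_inv_self {ρ : RepSpace} {z w : SurfaceGroup → ℍ[ℝ]} (hz : z ∈ Cocycle ρ)
    (g : SurfaceGroup) : cup ρ z w g⁻¹ g = -killing (z g) (w g) := by
  rw [cup, cocycle_inv hz, killing_neg_left, map_inv, killing_Ad]

/-- The pairing of the relative `2`-chain swept out by a half twist vanishes. -/
theorem cup_braid {ρ : RepSpace} {z w : SurfaceGroup → ℍ[ℝ]} (hw : w ∈ Cocycle ρ)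
    {g m m' : SurfaceGroup} (hm : m' * g = g * m) {ξ η : ℍ[ℝ]}
    (hη : z m' = Ad (ρ.1 m') η - η) (h : η = Ad (ρ.1 g) ξ - z g) :
    cup ρ z w m' g - killing η (w m') = cup ρ z w g m - killing ξ (w m) := by
  -- Expand w on both factorizations of m'g = gm.
  have e : w m' = w g + Ad (ρ.1 g) (w m) - Ad (ρ.1 m') (w g) := by
    rw [eq_sub_iff_add_eq, ← hw.2, ← hw.2, hm]
  have e₁ : killing η (Ad (ρ.1 g) (w m)) = killing ξ (w m) - cup ρ z w g m := by
    rw [h, killing_sub_left, killing_Ad, cup]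
  rw [cup, e, hη, killing_sub_left, killing_Ad, killing_sub_right, killing_add_right, e₁]
  ring

/-- The degenerate simplex [1|1] only corrects the boundary of the chain; it contributes nothing
because cocycles vanish at 1. -/
theorem relPairing_eq_cup {ρ : RepSpace} {z : SurfaceGroup → ℍ[ℝ]} (hz : z ∈ Cocycle ρ)
    (w : SurfaceGroup → ℍ[ℝ]) (ξ : Fin 4 → ℍ[ℝ]) :
    relPairing ρ z ξ w = cup ρ z w (mer 0) (mer 1) + cup ρ z w (mer 0 * mer 1) (mer 2) +
      cup ρ z w (mer 0 * mer 1 * mer 2) (mer 3) - (killing (ξ 0) (w (mer 0)) +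
        killing (ξ 1) (w (mer 1)) + killing (ξ 2) (w (mer 2)) + killing (ξ 3) (w (mer 3))) := by
  have h : killing (z 1) (Ad (ρ.1 1) (w 1)) = 0 := by
    rw [cocycle_one hz]; simp [killing]
  simp only [relPairing, fundChain, List.map_cons, List.map_nil, List.sum_cons, List.sum_nil,
    Fin.sum_univ_four, h, cup]
  ring

/-! ## Pulling back cocycles -/

theorem pullRep_apply (φ : peripheralAut) (ρ : RepSpace) (g : SurfaceGroup) :
    (pullRep φ ρ).1 g = ρ.1 (φ.1 g) := rfl

theorem pullRep_pullRep_inv (φ : peripheralAut) (ρ : RepSpace) :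
    pullRep φ (pullRep φ⁻¹ ρ) = ρ := by
  refine Subtype.ext (MonoidHom.ext fun g => ?_)
  rw [pullRep_apply, pullRep_apply]
  exact congrArg ρ.1 (MulAut.inv_apply_self _ φ.1 g)

theorem pullRep_inv_pullRep (φ : peripheralAut) (ρ : RepSpace) :
    pullRep φ⁻¹ (pullRep φ ρ) = ρ := by
  refine Subtype.ext (MonoidHom.ext fun g => ?_)
  rw [pullRep_apply, pullRep_apply]
  exact congrArg ρ.1 (MulAut.apply_inv_self _ φ.1 g)

theorem cocycle_comp {ρ : RepSpace} {z : SurfaceGroup → ℍ[ℝ]} (hz : z ∈ Cocycle ρ)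
    (φ : peripheralAut) : z ∘ φ.1 ∈ Cocycle (pullRep φ ρ) :=
  ⟨fun g => hz.1 _, fun g h => by
    simp only [Function.comp_apply, map_mul, hz.2, pullRep_apply]⟩

theorem parCocycle_comp {ρ : RepSpace} {z : SurfaceGroup → ℍ[ℝ]} (hz : z ∈ ParCocycle ρ)
    (φ : peripheralAut) : z ∘ φ.1 ∈ ParCocycle (pullRep φ ρ) := by
  obtain ⟨hz, ξ, hξ⟩ := hz
  refine ⟨cocycle_comp hz φ, ?_⟩
  obtain ⟨s, hs⟩ := φ.2
  have h : ∀ i, ∃ η : ℍ[ℝ], η ∈ su2 ∧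
      z (φ.1 (mer i)) = Ad (ρ.1 (φ.1 (mer i))) η - η := by
    intro i
    obtain ⟨g, hg⟩ := isConj_iff.1 (hs i)
    rw [← hg]
    exact ⟨_, su2.sub_mem (Ad_mem_su2 _ (hξ (s i)).1) (hz.1 g), cocycle_conj hz g _ (hξ (s i)).2⟩
  choose η hη hη' using h
  exact ⟨η, fun i => ⟨hη i, hη' i⟩⟩

theorem parCocycle_comp_iff {ρ : RepSpace} {z : SurfaceGroup → ℍ[ℝ]} (φ : peripheralAut) :
    z ∘ φ.1 ∈ ParCocycle (pullRep φ ρ) ↔ z ∈ ParCocycle ρ := by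
  refine ⟨fun h => ?_, fun h => parCocycle_comp h φ⟩
  have h' := parCocycle_comp h φ⁻¹
  rw [pullRep_inv_pullRep] at h'
  have e : (z ∘ φ.1) ∘ (φ⁻¹).1 = z := by
    funext g
    exact congrArg z (MulAut.apply_inv_self _ φ.1 g)
  rwa [e] at h'

/-! ### Invariance of the intersection pairing under the half twists -/

/-- The automorphism preserves the intersection pairing of parabolic cocycles. -/
def PreservesPairing (φ : peripheralAut) : Prop :=
  ∀ ρ z w ξ ξ', z ∈ ParCocycle ρ → w ∈ ParCocycle ρ → IsRelLift ρ z ξ →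
    IsRelLift (pullRep φ ρ) (z ∘ φ.1) ξ' →
    relPairing (pullRep φ ρ) (z ∘ φ.1) ξ' (w ∘ φ.1) = relPairing ρ z ξ w

/-- Since the pairing does not depend on the boundary elements, one convenient choice for the
pulled-back cocycle suffices. -/
theorem preservesPairing_of_exists {φ : peripheralAut}
    (h : ∀ ρ z w ξ, z ∈ Cocycle ρ → w ∈ Cocycle ρ → IsRelLift ρ z ξ →
      ∃ ξ', IsRelLift (pullRep φ ρ) (z ∘ φ.1) ξ' ∧
        relPairing (pullRep φ ρ) (z ∘ φ.1) ξ' (w ∘ φ.1) = relPairing ρ z ξ w) :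
    PreservesPairing φ := by
  intro ρ z w ξ ξ' hz hw hξ hξ'
  obtain ⟨ξ'', h₁, h₂⟩ := h ρ z w ξ hz.1 hw.1 hξ
  rw [← h₂]
  exact relPairing_lift_indep _ hξ' h₁ (parCocycle_comp hw φ)

theorem PreservesPairing.one : PreservesPairing 1 :=
  preservesPairing_of_exists fun _ _ _ ξ _ _ hξ => ⟨ξ, hξ, rfl⟩

theorem PreservesPairing.mul {φ ψ : peripheralAut} (hφ : PreservesPairing φ)
    (hψ : PreservesPairing ψ) : PreservesPairing (φ * ψ) := by
  intro ρ z w ξ ξ' hz hw hξ hξ'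
  obtain ⟨-, η, hη⟩ := parCocycle_comp hz φ
  exact (hψ (pullRep φ ρ) (z ∘ φ.1) (w ∘ φ.1) η ξ' (parCocycle_comp hz φ) (parCocycle_comp hw φ)
    hη hξ').trans (hφ ρ z w ξ η hz hw hξ hη)

theorem PreservesPairing.inv {φ : peripheralAut} (hφ : PreservesPairing φ) :
    PreservesPairing φ⁻¹ := by
  intro ρ z w ξ ξ' hz hw hξ hξ'
  have e : ∀ z : SurfaceGroup → ℍ[ℝ], (z ∘ (φ⁻¹).1) ∘ φ.1 = z := fun z => by
    funext g
    exact congrArg z (MulAut.inv_apply_self _ φ.1 g)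
  have h := hφ (pullRep φ⁻¹ ρ) (z ∘ (φ⁻¹).1) (w ∘ (φ⁻¹).1) ξ' ξ (parCocycle_comp hz _)
    (parCocycle_comp hw _) hξ' (by rwa [e, pullRep_pullRep_inv])
  rw [e, e, pullRep_pullRep_inv] at h
  exact h.symm

/-- With d' = d⁻¹cd, the twist replaces [ab|c] + [abc|d] by [ab|d] + [abd|d']. Re-bracketing gives
[c|d] + [ab|cd] and [d|d'] + [ab|dd']. As dd' = cd, only [c|d] and [d|d'] differ, and `cup_braid`
matches them together with the boundary terms. -/
theorem preservesPairing_halfTwist₁ : PreservesPairing ⟨halfTwist₁, halfTwist₁_mem⟩ := by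
  refine preservesPairing_of_exists fun ρ z w ξ hz hw hξ => ?_
  set φ : peripheralAut := ⟨halfTwist₁, halfTwist₁_mem⟩
  have f0 : φ.1 (mer 0) = mer 0 := halfTwist₁_mer 0
  have f1 : φ.1 (mer 1) = mer 1 := halfTwist₁_mer 1
  have f2 : φ.1 (mer 2) = mer 3 := (halfTwist₁_mer 2).trans mer_three.symm
  have f3 : φ.1 (mer 3) = (mer 3)⁻¹ * mer 2 * (mer 3)⁻¹⁻¹ := by
    rw [inv_inv]; exact halfTwist₁_mer 3
  let η : ℍ[ℝ] := Ad (ρ.1 (mer 3)⁻¹) (ξ 2) - z (mer 3)⁻¹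
  have hη : z (φ.1 (mer 3)) = Ad (ρ.1 (φ.1 (mer 3))) η - η := by
    rw [f3]; exact cocycle_conj hz _ _ (hξ 2).2
  refine ⟨![ξ 0, ξ 1, ξ 3, η], ?_, ?_⟩
  · intro i
    rw [pullRep_apply, Function.comp_apply]
    fin_cases i
    · exact ⟨(hξ 0).1, by rw [Fin.zero_eta, f0]; exact (hξ 0).2⟩
    · exact ⟨(hξ 1).1, by rw [Fin.mk_one, f1]; exact (hξ 1).2⟩
    · exact ⟨(hξ 3).1, by
        change z (φ.1 (mer 2)) = Ad (ρ.1 (φ.1 (mer 2))) (ξ 3) - ξ 3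
        rw [f2]; exact (hξ 3).2⟩
    · exact ⟨su2.sub_mem (Ad_mem_su2 _ (hξ 2).1) (hz.1 _), hη⟩
  · rw [relPairing_eq_cup (cocycle_comp hz φ), relPairing_eq_cup hz]
    have b := cup_braid (ρ := ρ) (z := z) hw (g := mer 3) (m := φ.1 (mer 3)) (m' := mer 2)
      (ξ := η) (by rw [f3]; group) (hξ 2).2 (by
        simp only [η]
        rw [map_sub, cocycle_inv hz, map_neg, map_inv, Ad_Ad_inv, Ad_Ad_inv]
        abel)
    have c₁ := cup_cocycle hz hw (mer 0 * mer 1) (mer 2) (mer 3)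
    have c₂ := cup_cocycle hz hw (mer 0 * mer 1) (mer 3) (φ.1 (mer 3))
    have e : mer 3 * φ.1 (mer 3) = mer 2 * mer 3 := by rw [f3]; group
    rw [e] at c₂
    have k₁ : cup (pullRep φ ρ) (z ∘ φ.1) (w ∘ φ.1) (mer 0) (mer 1) =
        cup ρ z w (mer 0) (mer 1) := by
      change cup ρ z w (φ.1 (mer 0)) (φ.1 (mer 1)) = _
      rw [f0, f1]
    have k₂ : cup (pullRep φ ρ) (z ∘ φ.1) (w ∘ φ.1) (mer 0 * mer 1) (mer 2) =
        cup ρ z w (mer 0 * mer 1) (mer 3) := by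
      change cup ρ z w (φ.1 (mer 0 * mer 1)) (φ.1 (mer 2)) = _
      rw [map_mul, f0, f1, f2]
    have k₃ : cup (pullRep φ ρ) (z ∘ φ.1) (w ∘ φ.1) (mer 0 * mer 1 * mer 2) (mer 3) =
        cup ρ z w (mer 0 * mer 1 * mer 3) (φ.1 (mer 3)) := by
      change cup ρ z w (φ.1 (mer 0 * mer 1 * mer 2)) (φ.1 (mer 3)) = _
      rw [map_mul, map_mul, f0, f1, f2]
    rw [k₁, k₂, k₃]
    change _ - (killing (ξ 0) (w (φ.1 (mer 0))) + killing (ξ 1) (w (φ.1 (mer 1))) +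
      killing (ξ 3) (w (φ.1 (mer 2))) + killing η (w (φ.1 (mer 3)))) = _
    rw [f0, f1, f2]
    linarith

/-- With b' = cdc⁻¹ and d' = aba⁻¹, the twisted chain is [a|b'] + [ab'|c] + [d'⁻¹|d']. The cocycle
identities reduce its pairing to that of [b'|c] + [d'|a] and the original one to that of [a|b] +
[c|d], with the same correction -{z(ab), w(ab)}. Two uses of `cup_braid`, conjugating by c and by a,
match them. -/
theorem preservesPairing_halfTwist₂ : PreservesPairing ⟨halfTwist₂, halfTwist₂_mem⟩ := by
  refine preservesPairing_of_exists fun ρ z w ξ hz hw hξ => ?_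
  set φ : peripheralAut := ⟨halfTwist₂, halfTwist₂_mem⟩
  have f0 : φ.1 (mer 0) = mer 0 := halfTwist₂_mer 0
  have f1 : φ.1 (mer 1) = mer 2 * mer 3 * (mer 2)⁻¹ := (halfTwist₂_mer 1).trans (by
    change (mer 1)⁻¹ * (mer 0)⁻¹ * (mer 2)⁻¹ = _
    rw [mer_three]; group)
  have f2 : φ.1 (mer 2) = mer 2 := halfTwist₂_mer 2
  have f3 : φ.1 (mer 3) = mer 0 * mer 1 * (mer 0)⁻¹ := halfTwist₂_mer 3
  let η : ℍ[ℝ] := Ad (ρ.1 (mer 2)) (ξ 3) - z (mer 2)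
  let θ : ℍ[ℝ] := Ad (ρ.1 (mer 0)) (ξ 1) - z (mer 0)
  have hη : z (φ.1 (mer 1)) = Ad (ρ.1 (φ.1 (mer 1))) η - η := by
    rw [f1]; exact cocycle_conj hz _ _ (hξ 3).2
  have hθ : z (φ.1 (mer 3)) = Ad (ρ.1 (φ.1 (mer 3))) θ - θ := by
    rw [f3]; exact cocycle_conj hz _ _ (hξ 1).2
  refine ⟨![ξ 0, η, ξ 2, θ], ?_, ?_⟩
  · intro i
    rw [pullRep_apply, Function.comp_apply]
    fin_cases i
    · exact ⟨(hξ 0).1, by rw [Fin.zero_eta, f0]; exact (hξ 0).2⟩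
    · exact ⟨su2.sub_mem (Ad_mem_su2 _ (hξ 3).1) (hz.1 _), hη⟩
    · exact ⟨(hξ 2).1, by
        change z (φ.1 (mer 2)) = Ad (ρ.1 (φ.1 (mer 2))) (ξ 2) - ξ 2
        rw [f2]; exact (hξ 2).2⟩
    · exact ⟨su2.sub_mem (Ad_mem_su2 _ (hξ 1).1) (hz.1 _), hθ⟩
  · rw [relPairing_eq_cup (cocycle_comp hz φ), relPairing_eq_cup hz]
    set b' := φ.1 (mer 1)
    set d' := φ.1 (mer 3)
    have b₁ := cup_braid (ρ := ρ) (z := z) hw (g := mer 2) (m := mer 3) (m' := b')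
      (ξ := ξ 3) (by rw [f1]; group) hη rfl
    have b₂ := cup_braid (ρ := ρ) (z := z) hw (g := mer 0) (m := mer 1) (m' := d')
      (ξ := ξ 1) (by rw [f3]; group) hθ rfl
    have c₁ := cup_cocycle hz hw (mer 0 * mer 1) (mer 2) (mer 3)
    have c₂ := cup_cocycle hz hw (mer 0) b' (mer 2)
    have c₃ := cup_cocycle hz hw d' (mer 0) (mer 0 * mer 1)⁻¹
    have i₁ := cup_self_inv (z := z) hw (mer 0 * mer 1)
    have i₂ := cup_self_inv (z := z) hw d'
    have i₃ := cup_inv_self (w := w) hz d'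
    have e₁ : mer 2 * mer 3 = (mer 0 * mer 1)⁻¹ := by rw [mer_three]; group
    have e₂ : b' * mer 2 = (mer 0 * mer 1)⁻¹ := by rw [← e₁, f1]; group
    have e₃ : d' * mer 0 = mer 0 * mer 1 := by rw [f3]; group
    have e₄ : mer 0 * (mer 0 * mer 1)⁻¹ = d'⁻¹ := by rw [f3]; group
    have e₅ : mer 0 * b' * mer 2 = d'⁻¹ := by rw [mul_assoc, e₂, e₄]
    rw [e₁, i₁] at c₁
    rw [e₂] at c₂
    rw [e₃, e₄, i₁, i₂] at c₃
    have k₁ : cup (pullRep φ ρ) (z ∘ φ.1) (w ∘ φ.1) (mer 0) (mer 1) =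
        cup ρ z w (mer 0) b' := by
      change cup ρ z w (φ.1 (mer 0)) b' = _
      rw [f0]
    have k₂ : cup (pullRep φ ρ) (z ∘ φ.1) (w ∘ φ.1) (mer 0 * mer 1) (mer 2) =
        cup ρ z w (mer 0 * b') (mer 2) := by
      change cup ρ z w (φ.1 (mer 0 * mer 1)) (φ.1 (mer 2)) = _
      rw [map_mul, f0, f2]
    have k₃ : cup (pullRep φ ρ) (z ∘ φ.1) (w ∘ φ.1) (mer 0 * mer 1 * mer 2) (mer 3) =
        cup ρ z w d'⁻¹ d' := by
      change cup ρ z w (φ.1 (mer 0 * mer 1 * mer 2)) d' = _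
      rw [map_mul, map_mul, f0, f2, e₅]
    rw [k₁, k₂, k₃, i₃]
    change _ - (killing (ξ 0) (w (φ.1 (mer 0))) + killing η (w b') +
      killing (ξ 2) (w (φ.1 (mer 2))) + killing θ (w d')) = _
    rw [f0, f2]
    linarith

/-! ## Smoothness along families and of functions -/

theorem tangentClass_of_mem {m : ℝ × ℝ → RepSpace} {u v : ℝ × ℝ}
    (h : velocity m u v ∈ ParCocycle (m u)) :
    tangentClass m u v = Submodule.Quotient.mk ⟨velocity m u v, h⟩ := dif_pos h

theorem pulledBackForm_eq {m : ℝ × ℝ → RepSpace} {u v w : ℝ × ℝ}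
    (hv : velocity m u v ∈ ParCocycle (m u)) (hw : velocity m u w ∈ ParCocycle (m u))
    {ξ : Fin 4 → ℍ[ℝ]} (hξ : IsRelLift (m u) (velocity m u v) ξ) :
    pulledBackForm m u v w = relPairing (m u) (velocity m u v) ξ (velocity m u w) := by
  rw [pulledBackForm, tangentClass_of_mem hv, tangentClass_of_mem hw]
  exact abgForm_mk (m u) ⟨_, hv⟩ ⟨_, hw⟩ ξ hξ

/-- The default value 0 of `tangentClass` lets invariance of the pulled-back form hold without any
differentiability hypothesis on the family. -/
theorem pulledBackForm_eq_zero {m : ℝ × ℝ → RepSpace} {u v w : ℝ × ℝ}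
    (h : ¬(velocity m u v ∈ ParCocycle (m u) ∧ velocity m u w ∈ ParCocycle (m u))) :
    pulledBackForm m u v w = 0 := by
  rw [pulledBackForm]
  by_cases hv : velocity m u v ∈ ParCocycle (m u)
  · have e : tangentClass m u w = 0 := dif_neg fun hw => h ⟨hv, hw⟩
    rw [e, map_zero]
  · have e : tangentClass m u v = 0 := dif_neg hv
    rw [e, map_zero, LinearMap.zero_apply]

theorem velocity_pullRep (φ : peripheralAut) (m : ℝ × ℝ → RepSpace) (u v : ℝ × ℝ) :
    velocity (fun u => pullRep φ (m u)) u v = velocity m u v ∘ φ.1 := rfl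

theorem pulledBackForm_pullRep {φ : peripheralAut} (hφ : PreservesPairing φ)
    (m : ℝ × ℝ → RepSpace) (u v w : ℝ × ℝ) :
    pulledBackForm (fun u => pullRep φ (m u)) u v w = pulledBackForm m u v w := by
  have iff : ∀ v, velocity (fun u => pullRep φ (m u)) u v ∈ ParCocycle (pullRep φ (m u)) ↔
      velocity m u v ∈ ParCocycle (m u) := fun v => by
    rw [velocity_pullRep, parCocycle_comp_iff]
  by_cases h : velocity m u v ∈ ParCocycle (m u) ∧ velocity m u w ∈ ParCocycle (m u)
  · have hv' := (iff v).2 h.1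
    have hw' := (iff w).2 h.2
    obtain ⟨ξ, hξ⟩ := h.1.2
    obtain ⟨ξ', hξ'⟩ := hv'.2
    rw [pulledBackForm_eq (m := fun u => pullRep φ (m u)) hv' hw' hξ',
      pulledBackForm_eq h.1 h.2 hξ]
    rw [velocity_pullRep] at hξ'
    rw [velocity_pullRep, velocity_pullRep]
    exact hφ (m u) _ _ ξ ξ' h.1 h.2 hξ hξ'
  · rw [pulledBackForm_eq_zero h, pulledBackForm_eq_zero]
    exact fun h' => h ⟨(iff v).1 h'.1, (iff w).1 h'.2⟩

theorem SmoothFamilyOn.apply {U : Set (ℝ × ℝ)} {m : ℝ × ℝ → RepSpace} (h : SmoothFamilyOn U m)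
    (g : SurfaceGroup) : ContDiffOn ℝ ∞ (fun u => ((m u).1 g : ℍ[ℝ])) U := by
  obtain ⟨W, hW, hW'⟩ := exists_smooth_word g
  simp only [hW']
  exact hW.comp_contDiffOn h

theorem SmoothFamilyOn.pullRep {U : Set (ℝ × ℝ)} {m : ℝ × ℝ → RepSpace} (h : SmoothFamilyOn U m)
    (φ : peripheralAut) : SmoothFamilyOn U (fun u => pullRep φ (m u)) :=
  contDiffOn_pi.2 fun i => h.apply (φ.1 (mer i))

theorem exists_smooth_pullRep (φ : peripheralAut) :
    ∃ W : (Fin 4 → ℍ[ℝ]) → (Fin 4 → ℍ[ℝ]), ContDiff ℝ ∞ W ∧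
      ∀ ρ, coords (pullRep φ ρ) = W (coords ρ) := by
  choose W hW hW' using fun i => exists_smooth_word (φ.1 (mer i))
  exact ⟨fun c i => W i c, contDiff_pi.2 hW, fun ρ => funext fun i => hW' i ρ⟩

theorem SmoothAtRep.pull {f : CharVar → ℝ} {ρ : RepSpace} (φ : peripheralAut)
    (h : SmoothAtRep f (pullRep φ ρ)) : SmoothAtRep (f ∘ pullback φ) ρ := by
  obtain ⟨F, hF, hF'⟩ := h
  obtain ⟨W, hW, hW'⟩ := exists_smooth_pullRep φ
  refine ⟨F ∘ W, hF.comp hW, ?_⟩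
  filter_upwards [(continuous_pullRep φ).continuousAt.eventually hF'] with σ hσ
  rw [Function.comp_apply, Function.comp_apply, ← hW']
  exact hσ

theorem smoothAtRep_pull_iff {f : CharVar → ℝ} {ρ : RepSpace} (φ : peripheralAut) :
    SmoothAtRep f (pullRep φ ρ) ↔ SmoothAtRep (f ∘ pullback φ) ρ := by
  refine ⟨SmoothAtRep.pull φ, fun h => ?_⟩
  rw [← pullRep_inv_pullRep φ ρ] at h
  have h' := SmoothAtRep.pull φ⁻¹ h
  have e : (f ∘ pullback φ) ∘ pullback φ⁻¹ = f := by
    funext x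
    exact congrArg f ((pullback φ).apply_symm_apply x)
  rwa [e] at h'

theorem smoothAtRep_conjRep {f : CharVar → ℝ} {ρ : RepSpace} (g : SU2)
    (h : SmoothAtRep f (conjRep g ρ)) : SmoothAtRep f ρ := by
  obtain ⟨F, hF, hF'⟩ := h
  refine ⟨fun c => F fun i => (g : ℍ[ℝ]) * c i * star (g : ℍ[ℝ]), hF.comp (contDiff_pi.2 fun i =>
    (contDiff_const.mul (contDiff_apply ℝ _ i)).mul contDiff_const), ?_⟩
  filter_upwards [(continuous_conjRep g).continuousAt.eventually hF'] with σ hσ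
  rw [cls_conjRep] at hσ
  exact hσ

theorem smoothAtRep_congr {f : CharVar → ℝ} {ρ σ : RepSpace} (h : cls ρ = cls σ) :
    SmoothAtRep f ρ ↔ SmoothAtRep f σ := by
  have key : ∀ {ρ σ : RepSpace}, cls ρ = cls σ → SmoothAtRep f σ → SmoothAtRep f ρ := by
    intro ρ σ h hσ
    obtain ⟨g, rfl⟩ := exists_conjRep_of_cls_eq h
    exact smoothAtRep_conjRep g hσ
  exact ⟨key h.symm, key h⟩

/-- Composition with φ already lifts the map to representations, so the required family is m
composed with φ, over all of U. -/
theorem preservesABG_pullback {φ : peripheralAut} (hφ : PreservesPairing φ)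
    (hreg : pullback φ '' regSet = regSet) : PreservesABG (pullback φ) where
  maps_reg := hreg
  smooth_iff ρ σ _ hσ f := by
    have : cls σ = cls (pullRep φ ρ) := hσ
    rw [smoothAtRep_congr this, smoothAtRep_pull_iff]
  form_eq U m hU hm _ u₀ hu₀ :=
    ⟨U, fun u => pullRep φ (m u), hU, hu₀, subset_rfl, hm.pullRep φ, fun _ _ => rfl,
      fun u _ v w => pulledBackForm_pullRep hφ m u v w⟩

theorem exists_pullback_of_mem_closure {Ψ : CharVar ≃ₜ CharVar}
    (hΨ : Ψ ∈ Subgroup.closure {twistAction₁, twistAction₂}) :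
    ∃ φ, PreservesPairing φ ∧ Ψ = pullback φ := by
  induction hΨ using Subgroup.closure_induction with
  | mem x hx =>
    rcases hx with rfl | rfl
    · exact ⟨_, preservesPairing_halfTwist₁, rfl⟩
    · exact ⟨_, preservesPairing_halfTwist₂, rfl⟩
  | one => exact ⟨1, .one, Homeomorph.ext fun x => (pullCls_one x).symm⟩
  | mul x y _ _ hx hy =>
    obtain ⟨φ, hφ, rfl⟩ := hx
    obtain ⟨ψ, hψ, rfl⟩ := hy
    -- Pullback is contravariant, hence the reversed order.
    exact ⟨ψ * φ, hψ.mul hφ, Homeomorph.ext fun x => (pullCls_mul ψ φ x).symm⟩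
  | inv x _ hx =>
    obtain ⟨φ, hφ, rfl⟩ := hx
    exact ⟨φ⁻¹, hφ.inv, Homeomorph.ext fun _ => rfl⟩

/-! ## Conjugation invariance of the formal tangent space -/

theorem conjRep_inv_conjRep (g : SU2) (ρ : RepSpace) : conjRep g⁻¹ (conjRep g ρ) = ρ := by
  refine Subtype.ext (MonoidHom.ext fun x => ?_)
  rw [conjRep_apply, conjRep_apply]
  group

theorem Ad_conjRep (g : SU2) (ρ : RepSpace) (x : SurfaceGroup) (v : ℍ[ℝ]) :
    Ad ((conjRep g ρ).1 x) (Ad g v) = Ad g (Ad (ρ.1 x) v) := by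
  rw [conjRep_apply, Ad_mul, Ad_mul, Ad_inv_Ad]

/-- The adjoint action on cochains. -/
def AdCochain (g : SU2) : (SurfaceGroup → ℍ[ℝ]) ≃ₗ[ℝ] (SurfaceGroup → ℍ[ℝ]) where
  toFun z x := Ad g (z x)
  invFun z x := Ad g⁻¹ (z x)
  left_inv z := funext fun x => Ad_inv_Ad g (z x)
  right_inv z := funext fun x => Ad_Ad_inv g (z x)
  map_add' z w := funext fun x => map_add (Ad g) (z x) (w x)
  map_smul' r z := funext fun x => map_smul (Ad g) r (z x)

theorem AdCochain_apply (g : SU2) (z : SurfaceGroup → ℍ[ℝ]) (x : SurfaceGroup) :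
    AdCochain g z x = Ad g (z x) := rfl

theorem AdCochain_inv (g : SU2) (z : SurfaceGroup → ℍ[ℝ]) :
    AdCochain g (AdCochain g⁻¹ z) = z := (AdCochain g).apply_symm_apply z

theorem AdCochain_mem_parCocycle {ρ : RepSpace} {z : SurfaceGroup → ℍ[ℝ]} (g : SU2)
    (hz : z ∈ ParCocycle ρ) : AdCochain g z ∈ ParCocycle (conjRep g ρ) := by
  obtain ⟨hz, ξ, hξ⟩ := hz
  refine ⟨⟨fun x => Ad_mem_su2 g (hz.1 x), fun x y => ?_⟩, fun i => Ad g (ξ i), fun i =>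
    ⟨Ad_mem_su2 g (hξ i).1, ?_⟩⟩
  · rw [AdCochain_apply, AdCochain_apply, AdCochain_apply, hz.2, map_add, Ad_conjRep]
  · rw [AdCochain_apply, (hξ i).2, map_sub, Ad_conjRep]

theorem AdCochain_mem_coboundary {ρ : RepSpace} {z : SurfaceGroup → ℍ[ℝ]} (g : SU2)
    (hz : z ∈ Coboundary ρ) : AdCochain g z ∈ Coboundary (conjRep g ρ) := by
  obtain ⟨η, hη, hz⟩ := hz
  refine ⟨Ad g η, Ad_mem_su2 g hη, fun x => ?_⟩
  rw [AdCochain_apply, hz, map_sub, Ad_conjRep]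

theorem AdCochain_mem_parCocycle_iff {ρ : RepSpace} {z : SurfaceGroup → ℍ[ℝ]} (g : SU2) :
    AdCochain g z ∈ ParCocycle (conjRep g ρ) ↔ z ∈ ParCocycle ρ := by
  refine ⟨fun h => ?_, AdCochain_mem_parCocycle g⟩
  have h' := AdCochain_mem_parCocycle g⁻¹ h
  rw [conjRep_inv_conjRep] at h'
  rwa [show AdCochain g⁻¹ (AdCochain g z) = z from (AdCochain g).symm_apply_apply z] at h'

theorem AdCochain_mem_coboundary_iff {ρ : RepSpace} {z : SurfaceGroup → ℍ[ℝ]} (g : SU2) :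
    AdCochain g z ∈ Coboundary (conjRep g ρ) ↔ z ∈ Coboundary ρ := by
  refine ⟨fun h => ?_, AdCochain_mem_coboundary g⟩
  have h' := AdCochain_mem_coboundary g⁻¹ h
  rw [conjRep_inv_conjRep] at h'
  rwa [show AdCochain g⁻¹ (AdCochain g z) = z from (AdCochain g).symm_apply_apply z] at h'

theorem map_AdCochain_parCocycle (g : SU2) (ρ : RepSpace) :
    (ParCocycle ρ).map (AdCochain g : _ →ₗ[ℝ] _) = ParCocycle (conjRep g ρ) := by
  ext z
  rw [Submodule.mem_map]
  constructor
  · rintro ⟨w, hw, rfl⟩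
    exact AdCochain_mem_parCocycle g hw
  · intro hz
    refine ⟨AdCochain g⁻¹ z, ?_, AdCochain_inv g z⟩
    rw [← AdCochain_mem_parCocycle_iff g, AdCochain_inv]
    exact hz

/-- The isomorphism of formal tangent spaces induced by conjugation. -/
def hhatConj (g : SU2) (ρ : RepSpace) : Hhat ρ ≃ₗ[ℝ] Hhat (conjRep g ρ) :=
  Submodule.Quotient.equiv _ _
    (LinearEquiv.ofSubmodules (AdCochain g) _ _ (map_AdCochain_parCocycle g ρ)) (by
      ext z
      rw [Submodule.mem_map]
      constructor
      · rintro ⟨w, hw, rfl⟩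
        exact AdCochain_mem_coboundary g hw
      · intro hz
        refine ⟨(LinearEquiv.ofSubmodules (AdCochain g) _ _
          (map_AdCochain_parCocycle g ρ)).symm z, ?_, LinearEquiv.apply_symm_apply _ z⟩
        refine (AdCochain_mem_coboundary_iff g).1 ?_
        change AdCochain g ((AdCochain g).symm z.1) ∈ _
        rw [LinearEquiv.apply_symm_apply]
        exact hz)

/-- Regularity quantifies over every representative of a class; this reduces the dimension count to
torus representations. -/
theorem finrank_hhat_congr {ρ σ : RepSpace} (h : cls ρ = cls σ) :
    Module.finrank ℝ (Hhat ρ) = Module.finrank ℝ (Hhat σ) := by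
  obtain ⟨g, rfl⟩ := exists_conjRep_of_cls_eq h
  exact (hhatConj g ρ).finrank_eq

/-! ## The differential of the torus family -/

theorem coe_mul_star_su2 (g : SU2) : (g : ℍ[ℝ]) * star (g : ℍ[ℝ]) = 1 :=
  Unitary.coe_mul_star_self g

/-- Differentiating |m(g)|² = 1 makes the velocity imaginary, and the product rule for m(gk) =
m(g)m(k), right translated, is the cocycle identity. -/
theorem velocity_mem_cocycle {m : ℝ × ℝ → RepSpace} {u : ℝ × ℝ}
    (h : ∀ g, DifferentiableAt ℝ (fun u' => ((m u').1 g : ℍ[ℝ])) u) (v : ℝ × ℝ) :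
    velocity m u v ∈ Cocycle (m u) := by
  refine ⟨fun g => ?_, fun g k => ?_⟩
  · change (fderiv ℝ (fun u' => ((m u').1 g : ℍ[ℝ])) u v * star ((m u).1 g : ℍ[ℝ])).re = 0
    have e : (fun u' => inner ℝ ((m u').1 g : ℍ[ℝ]) ((m u').1 g : ℍ[ℝ])) = fun _ => (1 : ℝ) := by
      funext u'
      rw [Quaternion.inner_def, coe_mul_star_su2, Quaternion.re_one]
    have d := fderiv_inner_apply ℝ (h g) (h g) v
    rw [e, fderiv_fun_const, real_inner_comm, ← two_mul] at d
    rw [← Quaternion.inner_def]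
    have d' : (0 : ℝ) = 2 * inner ℝ (fderiv ℝ (fun u' => ((m u').1 g : ℍ[ℝ])) u v)
      ((m u).1 g : ℍ[ℝ]) := d
    linarith
  · have hk := coe_mul_star_su2 ((m u).1 k)
    simp only [velocity, fderiv_fun_mul' (h g) (h k), Ad, LinearMap.coe_mk, AddHom.coe_mk,
      map_mul, Submonoid.coe_mul, star_mul, add_apply,
      smul_apply, smul_eq_mul, add_mul]
    rw [add_comm]
    congr 1
    · change fderiv ℝ (fun u' => ((m u').1 g : ℍ[ℝ])) u v * ((m u).1 k : ℍ[ℝ]) *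
        (star ((m u).1 k : ℍ[ℝ]) * star ((m u).1 g : ℍ[ℝ])) = _
      rw [mul_assoc, ← mul_assoc _ (star ((m u).1 k : ℍ[ℝ])), hk, one_mul]
    · simp only [mul_assoc]

/-- The family of representations `(x, y) ↦ (a ↦ j, b ↦ e^{ix} j, c ↦ e^{iy} j)`. -/
def torusFam (u : ℝ × ℝ) : RepSpace := torusRep (expT u)

theorem circJ_exp (x : ℝ) :
    (circJ (Circle.exp x) : ℍ[ℝ]) = Real.cos x • quat 0 0 1 0 + Real.sin x • quat 0 0 0 1 := by
  ext <;> simp [circJ_re, circJ_imI, circJ_imJ, circJ_imK, Circle.coe_exp,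
    Complex.exp_ofReal_mul_I_re, Complex.exp_ofReal_mul_I_im]

/-- The angles of the four meridians in the torus family. -/
def angle (i : Fin 4) : ℝ × ℝ →L[ℝ] ℝ :=
  ![0, ContinuousLinearMap.fst ℝ ℝ ℝ, ContinuousLinearMap.snd ℝ ℝ ℝ,
    ContinuousLinearMap.snd ℝ ℝ ℝ - ContinuousLinearMap.fst ℝ ℝ ℝ] i

theorem torusFam_mer (u : ℝ × ℝ) (i : Fin 4) :
    (torusFam u).1 (mer i) = circJ (Circle.exp (angle i u)) := by
  rw [torusFam, torusRep_mer]
  fin_cases i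
  · exact congrArg circJ Circle.exp_zero.symm
  · rfl
  · rfl
  · refine congrArg circJ ?_
    change Circle.exp u.2 * (Circle.exp u.1)⁻¹ = Circle.exp (u.2 - u.1)
    rw [Circle.exp_sub, div_eq_mul_inv]

theorem smoothFamilyOn_torusFam : SmoothFamilyOn Set.univ torusFam := by
  refine contDiffOn_univ.2 (contDiff_pi.2 fun i => ?_)
  simp only [coords, torusFam_mer, circJ_exp]
  exact ((Real.contDiff_cos.comp (angle i).contDiff).smul contDiff_const).add
    ((Real.contDiff_sin.comp (angle i).contDiff).smul contDiff_const)

theorem velocity_torusFam_mem_cocycle (u v : ℝ × ℝ) :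
    velocity torusFam u v ∈ Cocycle (torusFam u) :=
  velocity_mem_cocycle (fun g => ((contDiffOn_univ.1
    (smoothFamilyOn_torusFam.apply g)).differentiable (by simp)).differentiableAt) v

/-- The derivative of e^{iθ}j is θ' i e^{iθ}j, and right translation leaves θ' i. -/
theorem velocity_torusFam_mer (u v : ℝ × ℝ) (i : Fin 4) :
    velocity torusFam u v (mer i) = angle i v • quat 0 1 0 0 := by
  have h : HasFDerivAt (fun u' => ((torusFam u').1 (mer i) : ℍ[ℝ]))
      (((-Real.sin (angle i u)) • angle i).smulRight (quat 0 0 1 0) +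
        ((Real.cos (angle i u)) • angle i).smulRight (quat 0 0 0 1)) u := by
    simp only [torusFam_mer, circJ_exp]
    exact ((angle i).hasFDerivAt.cos.smul_const _).add ((angle i).hasFDerivAt.sin.smul_const _)
  rw [velocity, h.fderiv, torusFam_mer, circJ_exp]
  have hs := Real.sin_sq_add_cos_sq (angle i u)
  refine quaternion_ext ?_ ?_ ?_ ?_ <;>
    simp [Quaternion.re_mul, Quaternion.imI_mul, Quaternion.imJ_mul, Quaternion.imK_mul]
  · ring
  · linear_combination (angle i v) * hs

theorem Ad_circJ (z : Circle) (v : ℍ[ℝ]) :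
    Ad (circJ z) v = quat v.re (-v.imI)
      (((z : ℂ).re ^ 2 - (z : ℂ).im ^ 2) * v.imJ + 2 * (z : ℂ).re * (z : ℂ).im * v.imK)
      (2 * (z : ℂ).re * (z : ℂ).im * v.imJ + ((z : ℂ).im ^ 2 - (z : ℂ).re ^ 2) * v.imK) := by
  have hz := circle_re_im z
  change (circJ z : ℍ[ℝ]) * v * star (circJ z : ℍ[ℝ]) = _
  refine quaternion_ext ?_ ?_ ?_ ?_ <;>
    simp only [Quaternion.re_mul, Quaternion.imI_mul, Quaternion.imJ_mul, Quaternion.imK_mul,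
      Quaternion.re_star, Quaternion.imI_star, Quaternion.imJ_star, Quaternion.imK_star,
      circJ_re, circJ_imI, circJ_imJ, circJ_imK, quat_re, quat_imI, quat_imJ, quat_imK]
  · linear_combination v.re * hz
  · linear_combination -v.imI * hz
  · ring
  · ring

theorem Ad_torusFam_mer (u : ℝ × ℝ) (i : Fin 4) (r : ℝ) :
    Ad ((torusFam u).1 (mer i)) (r • quat 0 1 0 0) = -r • quat 0 1 0 0 := by
  rw [torusFam_mer, Ad_circJ]
  refine quaternion_ext ?_ ?_ ?_ ?_ <;> simp

/-- Each meridian acts on ℝi by -1, so the coboundary of ξ ∈ ℝi there is -2ξ; hence the factor -1/2.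
-/
theorem isRelLift_velocity (u v : ℝ × ℝ) : IsRelLift (torusFam u) (velocity torusFam u v)
    (fun i => (-(angle i v) / 2) • quat 0 1 0 0) := by
  intro i
  refine ⟨su2.smul_mem _ (quat_re 0 1 0 0), ?_⟩
  rw [velocity_torusFam_mer, Ad_torusFam_mer, ← sub_smul]
  congr 1
  ring

theorem velocity_torusFam_mem (u v : ℝ × ℝ) :
    velocity torusFam u v ∈ ParCocycle (torusFam u) :=
  ⟨velocity_torusFam_mem_cocycle u v, _, isRelLift_velocity u v⟩

theorem killing_imI (r s : ℝ) : killing (r • quat 0 1 0 0) (s • quat 0 1 0 0) = r * s := by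
  simp [killing, Quaternion.re_mul, mul_comm]

/-- Everything happens in ℝi with meridians acting by -1. The chain contributes -v₁w₂ - (v₂ - v₁)(w₂
- w₁) and the boundary ½(v₁w₁ + v₂w₂ + (v₂ - v₁)(w₂ - w₁)); the symmetric parts cancel. -/
theorem pulledBackForm_torusFam (u v w : ℝ × ℝ) :
    pulledBackForm torusFam u v w = -1 / 2 * (v.1 * w.2 - v.2 * w.1) := by
  have hz := velocity_torusFam_mem_cocycle u v
  rw [pulledBackForm_eq (velocity_torusFam_mem u v) (velocity_torusFam_mem u w)
    (isRelLift_velocity u v), relPairing_eq_cup hz]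
  simp only [cup, hz.2, map_mul, Ad_mul, velocity_torusFam_mer, Ad_torusFam_mer, ← add_smul,
    killing_imI]
  have a0 : ∀ v, angle 0 v = 0 := fun v => rfl
  have a1 : ∀ v, angle 1 v = v.1 := fun v => rfl
  have a2 : ∀ v, angle 2 v = v.2 := fun v => rfl
  have a3 : ∀ v, angle 3 v = v.2 - v.1 := fun v => rfl
  rw [a0, a0, a1, a1, a2, a2, a3, a3]
  ring

/-! ## Parabolic cocycles at the torus representations -/

theorem cocycle_eq_zero {ρ : RepSpace} {z : SurfaceGroup → ℍ[ℝ]} (hz : z ∈ Cocycle ρ)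
    (h₀ : z (mer 0) = 0) (h₁ : z (mer 1) = 0) (h₂ : z (mer 2) = 0) : z = 0 := by
  have mul : ∀ g h, z g = 0 → z h = 0 → z (g * h) = 0 := fun g h hg hh => by
    rw [hz.2, hg, hh, map_zero, add_zero]
  have inv : ∀ g, z g = 0 → z g⁻¹ = 0 := fun g hg => by
    rw [cocycle_inv hz, hg, map_zero, neg_zero]
  have h₃ : z (mer 3) = 0 := by
    rw [mer_three]
    exact mul _ _ (mul _ _ (inv _ h₂) (inv _ h₁)) (inv _ h₀)
  funext g
  have hg : g ∈ Subgroup.closure (Set.range (PresentedGroup.of (rels := relators))) := by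
    rw [PresentedGroup.closure_range_of]; trivial
  induction hg using Subgroup.closure_induction with
  | mem x hx =>
    obtain ⟨i, rfl⟩ := hx
    fin_cases i
    · exact h₀
    · exact h₁
    · exact h₂
    · exact h₃
  | one => exact cocycle_one hz
  | mul x y _ _ hx hy => exact mul x y hx hy
  | inv x _ hx => exact inv x hx

theorem coboundary_mem_cocycle (ρ : RepSpace) {η : ℍ[ℝ]} (hη : η ∈ su2) :
    (fun g => Ad (ρ.1 g) η - η) ∈ Cocycle ρ :=
  ⟨fun g => su2.sub_mem (Ad_mem_su2 _ hη) hη, fun g h => by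
    simp only [map_mul, Ad_mul, map_sub]; abel⟩

theorem cocycle_relation {ρ : RepSpace} {z : SurfaceGroup → ℍ[ℝ]} (hz : z ∈ Cocycle ρ) :
    z (mer 0) + Ad (ρ.1 (mer 0)) (z (mer 1)) + Ad (ρ.1 (mer 0)) (Ad (ρ.1 (mer 1)) (z (mer 2))) +
      Ad (ρ.1 (mer 0)) (Ad (ρ.1 (mer 1)) (Ad (ρ.1 (mer 2)) (z (mer 3)))) = 0 := by
  have h := cocycle_one hz
  rw [← mer_rel, hz.2, hz.2, hz.2] at h
  simpa only [map_mul, Ad_mul] using h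

/-- The tangent vector `α i + β i z j` to the sphere of traceless elements at `z j`. -/
def tang (z : Circle) (α β : ℝ) : ℍ[ℝ] := quat 0 α (-((z : ℂ).im * β)) ((z : ℂ).re * β)

theorem Ad_circJ_tang (w z : Circle) (α β : ℝ) :
    Ad (circJ w) (tang z α β) = tang (w * w * z⁻¹) (-α) (-β) := by
  rw [Ad_circJ]
  refine quaternion_ext ?_ ?_ ?_ ?_ <;>
    simp only [tang, quat_re, quat_imI, quat_imJ, quat_imK, Circle.coe_mul,
      Circle.coe_inv_eq_conj, Complex.mul_re, Complex.mul_im, Complex.conj_re, Complex.conj_im] <;>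
    ring

/-- `Ad` - 1 kills the axis zj and is -2 on its orthogonal complement. So a parabolic cocycle takes
tangential values on the meridians. -/
theorem Ad_circJ_sub (z : Circle) {ξ : ℍ[ℝ]} (hξ : ξ.re = 0) :
    Ad (circJ z) ξ - ξ =
      tang z (-2 * ξ.imI) (-2 * (-(z : ℂ).im * ξ.imJ + (z : ℂ).re * ξ.imK)) := by
  have hz := circle_re_im z
  rw [Ad_circJ]
  refine quaternion_ext ?_ ?_ ?_ ?_ <;>
    simp only [tang, quat_re, quat_imI, quat_imJ, quat_imK, Quaternion.re_sub,
      Quaternion.imI_sub, Quaternion.imJ_sub, Quaternion.imK_sub, hξ]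
  · ring
  · ring
  · linear_combination ξ.imJ * hz
  · linear_combination ξ.imK * hz

theorem tang_add (z : Circle) (α α' β β' : ℝ) :
    tang z α β + tang z α' β' = tang z (α + α') (β + β') := by
  refine quaternion_ext ?_ ?_ ?_ ?_ <;> simp [tang] <;> ring

theorem smul_imI_eq_tang (z : Circle) (r : ℝ) : r • quat 0 1 0 0 = tang z r 0 := by
  refine quaternion_ext ?_ ?_ ?_ ?_ <;> simp [tang]

/-- The β-parts form one complex equation, β₀ - β₁z⁻¹ + β₂z⁻²w - β₃z⁻¹w = 0. Multiplication by zw⁻¹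
makes the coefficient of β₃ real, so the imaginary part eliminates β₃. -/
theorem tang_relation {z w : Circle} {α₀ α₁ α₂ α₃ β₀ β₁ β₂ β₃ : ℝ}
    (h : tang 1 α₀ β₀ + Ad (circJ 1) (tang z α₁ β₁) +
      Ad (circJ 1) (Ad (circJ z) (tang w α₂ β₂)) +
      Ad (circJ 1) (Ad (circJ z) (Ad (circJ w) (tang (w * z⁻¹) α₃ β₃))) = 0) :
    (z : ℂ).im * (β₂ - (w : ℂ).re * β₀) = (w : ℂ).im * (β₁ - (z : ℂ).re * β₀) := by
  simp only [Ad_circJ_tang] at h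
  have hJ := congrArg (fun q : ℍ[ℝ] => q.imJ) h
  have hK := congrArg (fun q : ℍ[ℝ] => q.imK) h
  simp only [Quaternion.imJ_add, Quaternion.imK_add, tang, quat_imJ, quat_imK,
    Quaternion.imJ_zero, Quaternion.imK_zero] at hJ hK
  have e₁ : (1 : Circle) * 1 * z⁻¹ = z⁻¹ := by simp
  have e₂ : (1 : Circle) * 1 * (z * z * w⁻¹)⁻¹ = z⁻¹ * z⁻¹ * w := by
    simp [mul_comm]
  have e₃ : (1 : Circle) * 1 * (z * z * (w * w * (w * z⁻¹)⁻¹)⁻¹)⁻¹ = z⁻¹ * w := by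
    apply Subtype.ext
    push_cast
    field_simp
  rw [e₁, e₂, e₃] at hJ hK
  have E : (β₀ : ℂ) - β₁ * (z⁻¹ : Circle) + β₂ * (z⁻¹ * z⁻¹ * w : Circle)
      - β₃ * (z⁻¹ * w : Circle) = 0 := by
    apply Complex.ext
    · simp only [Complex.add_re, Complex.sub_re, Complex.ofReal_re, Complex.re_ofReal_mul,
        Complex.zero_re]
      simp only [Circle.coe_one, Complex.one_re] at hK
      linarith
    · simp only [Complex.add_im, Complex.sub_im, Complex.ofReal_im, Complex.im_ofReal_mul,
        Complex.zero_im]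
      simp only [Circle.coe_one, Complex.one_im] at hJ
      linarith
  have E' : (β₀ : ℂ) * (z * w⁻¹ : Circle) - β₁ * (w⁻¹ : Circle) + β₂ * (z⁻¹ : Circle)
      - β₃ = 0 := by
    have := congrArg (fun q : ℂ => q * (z * w⁻¹ : Circle)) E
    simp only [zero_mul] at this
    rw [← this]
    push_cast
    field_simp
  have F := congrArg Complex.im E'
  simp only [Complex.add_im, Complex.sub_im, Complex.ofReal_im,
    Complex.zero_im, Circle.coe_mul, Circle.coe_inv_eq_conj, Complex.mul_im, Complex.conj_re,
    Complex.conj_im, Complex.ofReal_re] at F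
  linarith

theorem ellInv_eq_iff (t : Circle × Circle) :
    ellInv t = t ↔ (t.1 : ℂ).im = 0 ∧ (t.2 : ℂ).im = 0 := by
  have key : ∀ z : Circle, z⁻¹ = z ↔ (z : ℂ).im = 0 := by
    intro z
    constructor
    · intro h
      have := congrArg (fun w : Circle => (w : ℂ).im) h
      simp only [Circle.coe_inv_eq_conj, Complex.conj_im] at this
      linarith
    · intro h
      refine circle_ext ?_ ?_ <;> simp [h]
  rw [ellInv, Prod.ext_iff, key, key]

theorem torusFam_mers (u : ℝ × ℝ) : (torusFam u).1 (mer 0) = circJ 1 ∧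
    (torusFam u).1 (mer 1) = circJ (Circle.exp u.1) ∧
    (torusFam u).1 (mer 2) = circJ (Circle.exp u.2) ∧
    (torusFam u).1 (mer 3) = circJ (Circle.exp u.2 * (Circle.exp u.1)⁻¹) :=
  ⟨torusRep_mer _ 0, torusRep_mer _ 1, torusRep_mer _ 2, torusRep_mer _ 3⟩

theorem exists_velocity_add_coboundary {u : ℝ × ℝ} (hu : ellInv (expT u) ≠ expT u)
    {z : SurfaceGroup → ℍ[ℝ]} (hz : z ∈ ParCocycle (torusFam u)) :
    ∃ v, z - velocity torusFam u v ∈ Coboundary (torusFam u) := by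
  obtain ⟨hz, ξ, hξ⟩ := hz
  obtain ⟨m0, m1, m2, m3⟩ := torusFam_mers u
  set Z := Circle.exp u.1
  set W := Circle.exp u.2
  have ht : ∀ i g, (torusFam u).1 (mer i) = circJ g → ∃ α β, z (mer i) = tang g α β := by
    intro i g hg
    rw [(hξ i).2, hg]
    exact ⟨_, _, Ad_circJ_sub _ (hξ i).1⟩
  obtain ⟨α₀, β₀, t0⟩ := ht 0 _ m0
  obtain ⟨α₁, β₁, t1⟩ := ht 1 _ m1
  obtain ⟨α₂, β₂, t2⟩ := ht 2 _ m2
  obtain ⟨α₃, β₃, t3⟩ := ht 3 _ m3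
  have hrel := cocycle_relation hz
  rw [t0, t1, t2, t3, m0, m1, m2] at hrel
  have key := tang_relation hrel
  set s₁ := (Z : ℂ).im
  set s₂ := (W : ℂ).im
  set c₁ := (Z : ℂ).re
  set c₂ := (W : ℂ).re
  have hs : s₁ ^ 2 + s₂ ^ 2 ≠ 0 := by
    intro h0
    apply hu
    rw [ellInv_eq_iff]
    constructor
    · change s₁ = 0
      nlinarith [sq_nonneg s₁, sq_nonneg s₂]
    · change s₂ = 0
      nlinarith [sq_nonneg s₁, sq_nonneg s₂]
  -- By `key`, (β₁ - c₁β₀, β₂ - c₂β₀) is a multiple of (s₁, s₂), which is nonzero off the corners.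
  -- The projection formula gives half the factor without asking which sine is nonzero.
  let e := (s₁ * (β₁ - c₁ * β₀) + s₂ * (β₂ - c₂ * β₀)) / (2 * (s₁ ^ 2 + s₂ ^ 2))
  have he₁ : 2 * s₁ * e = β₁ - c₁ * β₀ := by
    simp only [e]
    field_simp
    linear_combination s₂ * key
  have he₂ : 2 * s₂ * e = β₂ - c₂ * β₀ := by
    simp only [e]
    field_simp
    linear_combination -s₁ * key
  -- At a meridian with cosine c and sine s, the coboundary of η has α-part α₀ and β-part 2se + cβ₀.
  -- Subtracting it removes all β-parts and leaves the multiples α - α₀ of i.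
  let η : ℍ[ℝ] := quat 0 (-α₀ / 2) e (-β₀ / 2)
  have hη : η ∈ su2 := quat_re _ _ _ _
  let v : ℝ × ℝ := (α₁ - α₀, α₂ - α₀)
  refine ⟨v, η, hη, fun g => ?_⟩
  have hη' : η.re = 0 := hη
  have hd : z - velocity torusFam u v - (fun g => Ad ((torusFam u).1 g) η - η) ∈
      Cocycle (torusFam u) :=
    sub_mem (sub_mem hz (velocity_torusFam_mem_cocycle u v)) (coboundary_mem_cocycle _ hη)
  have zero : z - velocity torusFam u v - (fun g => Ad ((torusFam u).1 g) η - η) = 0 := by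
    refine cocycle_eq_zero hd ?_ ?_ ?_
    · simp only [Pi.sub_apply]
      rw [sub_sub, sub_eq_zero, t0, velocity_torusFam_mer, m0, Ad_circJ_sub _ hη',
        smul_imI_eq_tang 1, tang_add]
      have a : angle 0 v = 0 := rfl
      rw [a]
      congr 1 <;> simp [η] <;> ring
    · simp only [Pi.sub_apply]
      rw [sub_sub, sub_eq_zero, t1, velocity_torusFam_mer, m1, Ad_circJ_sub _ hη',
        smul_imI_eq_tang Z, tang_add]
      have a : angle 1 v = α₁ - α₀ := rfl
      rw [a]
      congr 1
      · simp only [η, quat_imI]; ring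
      · simp only [η, quat_imJ, quat_imK]; linarith
    · simp only [Pi.sub_apply]
      rw [sub_sub, sub_eq_zero, t2, velocity_torusFam_mer, m2, Ad_circJ_sub _ hη',
        smul_imI_eq_tang W, tang_add]
      have a : angle 2 v = α₂ - α₀ := rfl
      rw [a]
      congr 1
      · simp only [η, quat_imI]; ring
      · simp only [η, quat_imJ, quat_imK]; linarith
  have := congrFun zero g
  simp only [Pi.sub_apply, Pi.zero_apply] at this
  rw [Pi.sub_apply]
  exact sub_eq_zero.1 this

/-- The differential of the torus family, as a map to parabolic cocycles. -/
def velocityMap (u : ℝ × ℝ) : ℝ × ℝ →ₗ[ℝ] ParCocycle (torusFam u) where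
  toFun v := ⟨velocity torusFam u v, velocity_torusFam_mem u v⟩
  map_add' v w := Subtype.ext (funext fun g => by
    simp only [velocity, map_add, add_mul, Submodule.coe_add, Pi.add_apply])
  map_smul' r v := Subtype.ext (funext fun g => by
    simp only [velocity, map_smul, smul_mul_assoc, Submodule.coe_smul, Pi.smul_apply,
      RingHom.id_apply])

/-- The differential of the torus family, as a map to the formal tangent space. -/
def differential (u : ℝ × ℝ) : ℝ × ℝ →ₗ[ℝ] Hhat (torusFam u) :=
  (Submodule.mkQ _).comp (velocityMap u)

theorem tangentClass_torusFam (u v : ℝ × ℝ) : tangentClass torusFam u v = differential u v :=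
  tangentClass_of_mem (velocity_torusFam_mem u v)

/-- The pulled-back form is nondegenerate, at the corners too. -/
theorem differential_injective (u : ℝ × ℝ) : Function.Injective (differential u) := by
  rw [injective_iff_map_eq_zero]
  intro v hv
  have key : ∀ w : ℝ × ℝ, v.1 * w.2 - v.2 * w.1 = 0 := by
    intro w
    have h := pulledBackForm_torusFam u v w
    rw [pulledBackForm, tangentClass_torusFam, hv, map_zero, LinearMap.zero_apply] at h
    linarith
  have h₁ := key (0, 1)
  have h₂ := key (1, 0)
  exact Prod.ext (by simpa using h₁) (by simpa using h₂)

theorem differential_surjective {u : ℝ × ℝ} (hu : ellInv (expT u) ≠ expT u) :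
    Function.Surjective (differential u) := by
  intro x
  obtain ⟨z, rfl⟩ := Submodule.Quotient.mk_surjective _ x
  obtain ⟨v, hv⟩ := exists_velocity_add_coboundary hu z.2
  refine ⟨v, Eq.symm ?_⟩
  exact (Submodule.Quotient.eq _).2 hv

theorem finrank_hhat_of_ne {u : ℝ × ℝ} (hu : ellInv (expT u) ≠ expT u) :
    Module.finrank ℝ (Hhat (torusFam u)) = 2 := by
  rw [← (LinearEquiv.ofBijective (differential u)
    ⟨differential_injective u, differential_surjective hu⟩).finrank_eq]
  simp

/-! ## The corners -/

/-- A rotation about the axis `j`. -/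
def rotJ : SU2 := ⟨quat (3 / 5) 0 (4 / 5) 0, mem_unitary_of_normSq (by
  rw [Quaternion.normSq_def']; simp; norm_num)⟩

theorem conjRep_rotJ {u : ℝ × ℝ} (hu : ellInv (expT u) = expT u) :
    conjRep rotJ (torusFam u) = torusFam u := by
  obtain ⟨h₁, h₂⟩ := (ellInv_eq_iff _).1 hu
  have comm : ∀ z : Circle, (z : ℂ).im = 0 → rotJ * circJ z * rotJ⁻¹ = circJ z := by
    intro z hz
    rw [mul_inv_eq_iff_eq_mul]
    apply Subtype.ext
    change quat (3 / 5) 0 (4 / 5) 0 * (circJ z : ℍ[ℝ]) = (circJ z : ℍ[ℝ]) * quat (3 / 5) 0 (4 / 5) 0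
    refine quaternion_ext ?_ ?_ ?_ ?_ <;>
      simp only [Quaternion.re_mul, Quaternion.imI_mul, Quaternion.imJ_mul, Quaternion.imK_mul,
        circJ_re, circJ_imI, circJ_imJ, circJ_imK, quat_re, quat_imI, quat_imJ, quat_imK, hz] <;>
      ring
  obtain ⟨m0, m1, m2, -⟩ := torusFam_mers u
  apply repSpace_ext
  · rw [conjRep_apply, m0]; exact comm 1 (by simp)
  · rw [conjRep_apply, m1]; exact comm _ h₁
  · rw [conjRep_apply, m2]; exact comm _ h₂

theorem Ad_rotJ (r : ℝ) : Ad rotJ (r • quat 0 1 0 0) = quat 0 (-(7 / 25) * r) 0 (-(24 / 25) * r) := by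
  change quat (3 / 5) 0 (4 / 5) 0 * (r • quat 0 1 0 0) * star (quat (3 / 5) 0 (4 / 5) 0) = _
  refine quaternion_ext ?_ ?_ ?_ ?_ <;>
    simp [Quaternion.re_mul, Quaternion.imI_mul, Quaternion.imJ_mul, Quaternion.imK_mul] <;> ring

/-- At a corner all meridians go to ±j, so rotations about j fix the representation and act on its
parabolic cocycles. Rotating a velocity gives values with a k-component, and thus a class
independent of the two-dimensional space of velocities. -/
theorem finrank_hhat_of_eq {u : ℝ × ℝ} (hu : ellInv (expT u) = expT u) :
    Module.finrank ℝ (Hhat (torusFam u)) ≠ 2 := by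
  intro h2
  obtain ⟨h₁, h₂⟩ := (ellInv_eq_iff _).1 hu
  have hx : AdCochain rotJ (velocity torusFam u (1, 0)) ∈ ParCocycle (torusFam u) := by
    have := AdCochain_mem_parCocycle rotJ (velocity_torusFam_mem u (1, 0))
    rwa [conjRep_rotJ hu] at this
  let x : ParCocycle (torusFam u) := ⟨_, hx⟩
  let T : (ℝ × ℝ) × ℝ →ₗ[ℝ] ParCocycle (torusFam u) :=
    (velocityMap u).coprod (LinearMap.toSpanSingleton ℝ _ x)
  have hT : ∀ p i, (T p).1 (mer i) = angle i p.1 • quat 0 1 0 0 +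
      p.2 • Ad rotJ (angle i (1, 0) • quat 0 1 0 0) := by
    intro p i
    rw [← velocity_torusFam_mer u, ← velocity_torusFam_mer u]
    rfl
  have inj : Function.Injective ((Submodule.mkQ
      ((Coboundary (torusFam u)).comap (ParCocycle (torusFam u)).subtype)).comp T) := by
    rw [injective_iff_map_eq_zero]
    rintro ⟨⟨p, q⟩, r⟩ hp
    obtain ⟨η, hη, hη'⟩ : (T ((p, q), r)).1 ∈ Coboundary (torusFam u) :=
      (Submodule.Quotient.mk_eq_zero
        ((Coboundary (torusFam u)).comap (ParCocycle (torusFam u)).subtype)).1 hp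
    obtain ⟨m0, m1, m2, -⟩ := torusFam_mers u
    have d0 := hη' (mer 0)
    have d1 := hη' (mer 1)
    have d2 := hη' (mer 2)
    have a0 : ∀ v, angle 0 v = 0 := fun v => rfl
    have a1 : ∀ v, angle 1 v = v.1 := fun v => rfl
    have a2 : ∀ v, angle 2 v = v.2 := fun v => rfl
    rw [hT, Ad_rotJ, m0, Ad_circJ_sub _ hη, a0, a0] at d0
    rw [hT, Ad_rotJ, m1, Ad_circJ_sub _ hη, a1, a1] at d1
    rw [hT, Ad_rotJ, m2, Ad_circJ_sub _ hη, a2, a2] at d2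
    have h₁' : (Circle.exp u.1 : ℂ).im = 0 := h₁
    have h₂' : (Circle.exp u.2 : ℂ).im = 0 := h₂
    have i0 := congrArg (fun q : ℍ[ℝ] => q.imI) d0
    have k0 := congrArg (fun q : ℍ[ℝ] => q.imK) d0
    have i1 := congrArg (fun q : ℍ[ℝ] => q.imI) d1
    have k1 := congrArg (fun q : ℍ[ℝ] => q.imK) d1
    have i2 := congrArg (fun q : ℍ[ℝ] => q.imI) d2
    simp only [tang, Quaternion.imI_add, Quaternion.imK_add, Quaternion.imI_smul,
      Quaternion.imK_smul, quat_imI, quat_imK, smul_eq_mul, Circle.coe_one, Complex.one_re,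
      Complex.one_im, h₁'] at i0 k0 i1 k1 i2
    -- The cocycle vanishes on the first meridian, which kills the i- and k-components of η; the
    -- k-part at the second meridian then gives r = 0.
    have e0 : η.imI = 0 := by linarith
    have e1 : η.imK = 0 := by linarith
    rw [e0] at i1 i2
    rw [e1] at k1
    have hr : r = 0 := by linarith
    rw [hr] at i1
    have hp0 : p = 0 := by linarith
    have hq0 : q = 0 := by linarith
    rw [hr, hp0, hq0]
    rfl
  -- Comparing ranks needs finite dimension, which a nonzero `finrank` supplies.
  have : Module.Finite ℝ (Hhat (torusFam u)) := Module.finite_of_finrank_pos (by rw [h2]; norm_num)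
  have hle := LinearMap.finrank_le_finrank_of_injective inj
  rw [h2] at hle
  simp at hle

/-! ## Regular points -/

theorem expT_surjective : Function.Surjective expT := by
  rintro ⟨z, w⟩
  obtain ⟨x, rfl⟩ := Circle.exp_surjective z
  obtain ⟨y, rfl⟩ := Circle.exp_surjective w
  exact ⟨(x, y), rfl⟩

theorem pillowPt_surjective : Function.Surjective pillowPt := by
  intro p
  induction p using Quotient.inductionOn with
  | h t =>
    obtain ⟨u, rfl⟩ := expT_surjective t
    exact ⟨u, rfl⟩

theorem continuous_expT : Continuous expT :=
  (Circle.exp.continuous.comp continuous_fst).prodMk (Circle.exp.continuous.comp continuous_snd)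

theorem continuous_pillowPt : Continuous pillowPt :=
  continuous_quotient_mk'.comp continuous_expT

theorem mk_mem_pillowReg {t : Circle × Circle} :
    Quotient.mk torusSetoid t ∈ pillowReg ↔ ellInv t ≠ t := by
  constructor
  · rintro ⟨s, hs, h⟩
    have h' : s = t ∨ s = ellInv t := Quotient.exact h
    rcases h' with rfl | rfl
    · exact hs
    · rw [ellInv_ellInv] at hs
      exact hs.symm
  · exact fun h => ⟨t, h, rfl⟩

theorem isOpen_pillowReg : IsOpen pillowReg := by
  have h : IsOpen {t : Circle × Circle | ellInv t ≠ t} :=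
    isOpen_ne_fun (continuous_fst.inv.prodMk continuous_snd.inv) continuous_id
  refine isOpen_coinduced.2 ?_
  convert h using 1
  ext t
  exact mk_mem_pillowReg

theorem rhoHat_pillowPt (u : ℝ × ℝ) : rhoHat (pillowPt u) = cls (torusFam u) := rfl

/-- If the sine vanished near a point, its derivative, the cosine, would vanish there as well.
Corners are therefore limits of points with a different dimension, hence not regular. -/
theorem frequently_noncorner (u : ℝ × ℝ) : ∃ᶠ v in 𝓝 u, ellInv (expT v) ≠ expT v := by
  intro h
  have h' : ∀ᶠ x in 𝓝 u.1, Real.sin x = 0 := by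
    have hc : Filter.Tendsto (fun x : ℝ => (x, u.2)) (𝓝 u.1) (𝓝 u) :=
      (continuous_id.prodMk continuous_const).tendsto u.1
    filter_upwards [hc.eventually h] with x hx
    have := ((ellInv_eq_iff _).1 (not_not.1 hx)).1
    rwa [expT, Circle.coe_exp, Complex.exp_ofReal_mul_I_im] at this
  have d : deriv Real.sin u.1 = 0 := by
    have e : Real.sin =ᶠ[𝓝 u.1] fun _ => 0 := h'
    rw [e.deriv_eq, deriv_const]
  rw [Real.deriv_sin] at d
  have s := h'.self_of_nhds
  have := Real.sin_sq_add_cos_sq u.1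
  rw [d, s] at this
  norm_num at this

theorem image_pillowReg : rhoHat '' pillowReg = regSet := by
  apply Set.eq_of_subset_of_subset
  · rintro _ ⟨p, hp, rfl⟩
    refine ⟨rhoHat '' pillowReg, (isHomeomorph_rhoHat.isOpenMap _ isOpen_pillowReg).mem_nhds
      ⟨p, hp, rfl⟩, 2, ?_⟩
    rintro ρ ⟨q, hq, h⟩
    obtain ⟨u, rfl⟩ := pillowPt_surjective q
    rw [finrank_hhat_congr (σ := torusFam u) h.symm]
    exact finrank_hhat_of_ne (mk_mem_pillowReg.1 hq)
  · rintro x ⟨U, hU, n, hn⟩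
    obtain ⟨p, rfl⟩ := rhoHat_surjective x
    obtain ⟨u, rfl⟩ := pillowPt_surjective p
    refine ⟨pillowPt u, mk_mem_pillowReg.2 fun hu => ?_, rfl⟩
    have hc : ∀ᶠ v in 𝓝 u, rhoHat (pillowPt v) ∈ U :=
      (continuous_rhoHat.comp continuous_pillowPt).continuousAt.eventually hU
    obtain ⟨v, hv, hvU⟩ := ((frequently_noncorner u).and_eventually hc).exists
    have h₁ := hn (torusFam u) hc.self_of_nhds
    have h₂ := hn (torusFam v) hvU
    rw [finrank_hhat_of_ne hv] at h₂
    exact finrank_hhat_of_eq hu (h₁.trans h₂.symm)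

/-! ## Smooth local coordinates -/

/-- `SmoothAtRep` asks for a function smooth on the whole ambient space; a bump function provides
one from a local formula. -/
theorem exists_contDiff_eventuallyEq {E : Type*} [NormedAddCommGroup E] [NormedSpace ℝ E]
    [FiniteDimensional ℝ E] {f : E → ℝ} {s : Set E} {x : E} (hf : ContDiffOn ℝ ∞ f s)
    (hs : IsOpen s) (hx : x ∈ s) : ∃ F : E → ℝ, ContDiff ℝ ∞ F ∧ ∀ᶠ y in 𝓝 x, f y = F y := by
  obtain ⟨ε, hε, hεs⟩ := Metric.isOpen_iff.1 hs x hx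
  let χ : ContDiffBump x := ⟨ε / 4, ε / 2, by positivity, by linarith⟩
  refine ⟨fun y => χ y * f y, contDiff_iff_contDiffAt.2 fun y => ?_, ?_⟩
  · by_cases hy' : y ∈ tsupport χ
    swap
    · refine contDiffAt_const (c := (0 : ℝ)) |>.congr_of_eventuallyEq ?_
      filter_upwards [notMem_tsupport_iff_eventuallyEq.1 hy'] with a ha
      rw [ha, Pi.zero_apply, zero_mul]
    rw [χ.tsupport_eq] at hy'
    have hys : y ∈ s := hεs (Metric.closedBall_subset_ball (by change ε / 2 < ε; linarith) hy')
    exact χ.contDiff.contDiffAt.mul (hf.contDiffAt (hs.mem_nhds hys))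
  · filter_upwards [χ.eventuallyEq_one] with y hy
    rw [hy, Pi.one_apply, one_mul]

/-- For (c, s) = (cos θ, sin θ), the arcsine is taken of sin(θ - x), and positivity of cos(θ - x)
makes it θ - x modulo 2π. -/
theorem cos_sin_add_arcsin {x c s : ℝ} (h : c ^ 2 + s ^ 2 = 1)
    (hpos : 0 < c * Real.cos x + s * Real.sin x) :
    Real.cos (x + Real.arcsin (s * Real.cos x - c * Real.sin x)) = c ∧
    Real.sin (x + Real.arcsin (s * Real.cos x - c * Real.sin x)) = s := by
  have hx := Real.sin_sq_add_cos_sq x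
  have e : (c * Real.cos x + s * Real.sin x) ^ 2 = 1 - (s * Real.cos x - c * Real.sin x) ^ 2 := by
    linear_combination (Real.sin x ^ 2 + Real.cos x ^ 2) * h + hx
  have hcos : Real.cos (Real.arcsin (s * Real.cos x - c * Real.sin x)) =
      c * Real.cos x + s * Real.sin x := by
    rw [Real.cos_arcsin, ← e, Real.sqrt_sq hpos.le]
  have hsin : Real.sin (Real.arcsin (s * Real.cos x - c * Real.sin x)) =
      s * Real.cos x - c * Real.sin x := by
    apply Real.sin_arcsin <;> nlinarith [sq_nonneg (c * Real.cos x + s * Real.sin x)]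
  rw [Real.cos_add, Real.sin_add, hcos, hsin]
  constructor
  · linear_combination c * hx
  · linear_combination s * hx

section Coordinates

variable (u : ℝ × ℝ)

/-- The squared length of the normal vector `sin x A × B + sin y A × C`, in terms of the inner
products of `A, B, C`. -/
def normalSq (c : Fin 4 → ℍ[ℝ]) : ℝ :=
  Real.sin u.1 ^ 2 * (1 - killing (c 0) (c 1) ^ 2) +
    2 * Real.sin u.1 * Real.sin u.2 *
      (killing (c 1) (c 2) - killing (c 0) (c 1) * killing (c 0) (c 2)) +
    Real.sin u.2 ^ 2 * (1 - killing (c 0) (c 2) ^ 2)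

/-- The sine of the angle from `A` to `B`, oriented by the normal vector. -/
def sinB (c : Fin 4 → ℍ[ℝ]) : ℝ :=
  (Real.sin u.1 * (1 - killing (c 0) (c 1) ^ 2) + Real.sin u.2 *
    (killing (c 1) (c 2) - killing (c 0) (c 1) * killing (c 0) (c 2))) / Real.sqrt (normalSq u c)

/-- The sine of the angle from `A` to `C`, oriented by the normal vector. -/
def sinC (c : Fin 4 → ℍ[ℝ]) : ℝ :=
  (Real.sin u.1 * (killing (c 1) (c 2) - killing (c 0) (c 1) * killing (c 0) (c 2)) +
    Real.sin u.2 * (1 - killing (c 0) (c 2) ^ 2)) / Real.sqrt (normalSq u c)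

/-- The angles from `A` to `B` and from `A` to `C`, near their values at `u`. -/
def localAngles (c : Fin 4 → ℍ[ℝ]) : ℝ × ℝ :=
  (u.1 + Real.arcsin (sinB u c * Real.cos u.1 - killing (c 0) (c 1) * Real.sin u.1),
   u.2 + Real.arcsin (sinC u c * Real.cos u.2 - killing (c 0) (c 2) * Real.sin u.2))

/-- The region where `localAngles` is smooth and computes the angles. -/
def angleDomain : Set (Fin 4 → ℍ[ℝ]) :=
  {c | 0 < normalSq u c} ∩ (fun c =>
    ((sinB u c * Real.cos u.1 - killing (c 0) (c 1) * Real.sin u.1,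
      sinC u c * Real.cos u.2 - killing (c 0) (c 2) * Real.sin u.2),
     (killing (c 0) (c 1) * Real.cos u.1 + sinB u c * Real.sin u.1,
      killing (c 0) (c 2) * Real.cos u.2 + sinC u c * Real.sin u.2))) ⁻¹'
    ((Set.Ioo (-1) 1 ×ˢ Set.Ioo (-1) 1) ×ˢ (Set.Ioi 0 ×ˢ Set.Ioi 0))

theorem contDiff_killing_coord (i j : Fin 4) :
    ContDiff ℝ ∞ fun c : Fin 4 → ℍ[ℝ] => killing (c i) (c j) :=
  contDiff_killing (contDiff_apply ℝ _ i) (contDiff_apply ℝ _ j)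

theorem contDiff_normalSq : ContDiff ℝ ∞ (normalSq u) := by
  have h₁ := contDiff_killing_coord 0 1
  have h₂ := contDiff_killing_coord 0 2
  have h₃ := contDiff_killing_coord 1 2
  unfold normalSq
  fun_prop

theorem contDiffOn_sqrt_normalSq :
    ContDiffOn ℝ ∞ (fun c => Real.sqrt (normalSq u c)) {c | 0 < normalSq u c} :=
  (contDiff_normalSq u).contDiffOn.sqrt fun _ hc => ne_of_gt hc

theorem contDiffOn_sinB : ContDiffOn ℝ ∞ (sinB u) {c | 0 < normalSq u c} := by
  have h₁ := contDiff_killing_coord 0 1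
  have h₂ := contDiff_killing_coord 0 2
  have h₃ := contDiff_killing_coord 1 2
  refine ContDiffOn.div (ContDiff.contDiffOn ?_) (contDiffOn_sqrt_normalSq u)
    fun c hc => (Real.sqrt_pos.2 hc).ne'
  fun_prop

theorem contDiffOn_sinC : ContDiffOn ℝ ∞ (sinC u) {c | 0 < normalSq u c} := by
  have h₁ := contDiff_killing_coord 0 1
  have h₂ := contDiff_killing_coord 0 2
  have h₃ := contDiff_killing_coord 1 2
  refine ContDiffOn.div (ContDiff.contDiffOn ?_) (contDiffOn_sqrt_normalSq u)
    fun c hc => (Real.sqrt_pos.2 hc).ne'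
  fun_prop

theorem isOpen_angleDomain : IsOpen (angleDomain u) := by
  refine ContinuousOn.isOpen_inter_preimage ?_
    (isOpen_lt continuous_const (contDiff_normalSq u).continuous)
    ((isOpen_Ioo.prod isOpen_Ioo).prod (isOpen_Ioi.prod isOpen_Ioi))
  have h₁ := (contDiff_killing_coord 0 1).continuous.continuousOn (s := {c | 0 < normalSq u c})
  have h₂ := (contDiff_killing_coord 0 2).continuous.continuousOn (s := {c | 0 < normalSq u c})
  have hB := (contDiffOn_sinB u).continuousOn
  have hC := (contDiffOn_sinC u).continuousOn
  fun_prop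

theorem contDiffOn_localAngles : ContDiffOn ℝ ∞ (localAngles u) (angleDomain u) := by
  have h₁ := (contDiff_killing_coord 0 1).contDiffOn (s := angleDomain u)
  have h₂ := (contDiff_killing_coord 0 2).contDiffOn (s := angleDomain u)
  have hB := (contDiffOn_sinB u).mono (Set.inter_subset_left : angleDomain u ⊆ _)
  have hC := (contDiffOn_sinC u).mono (Set.inter_subset_left : angleDomain u ⊆ _)
  have arc : ContDiffOn ℝ ∞ Real.arcsin (Set.Ioo (-1) 1) := fun x hx =>
    (Real.contDiffAt_arcsin hx.1.ne' hx.2.ne).contDiffWithinAt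
  refine ContDiffOn.prodMk (contDiffOn_const.add (arc.comp ?_ fun c hc => hc.2.1.1))
    (contDiffOn_const.add (arc.comp ?_ fun c hc => hc.2.1.2))
  · exact (hB.mul contDiffOn_const).sub (h₁.mul contDiffOn_const)
  · exact (hC.mul contDiffOn_const).sub (h₂.mul contDiffOn_const)

/-- For a torus representation A × B = (Im z)i and A × C = (Im w)i, so the weighted normal is n i
with n = sin u₁ Im z + sin u₂ Im w. The sign n/|n| picks one of the two lifts exchanged by the
elliptic involution; the weights make n positive at u itself off the corners. -/
theorem sin_values {c : Fin 4 → ℍ[ℝ]} {z w : Circle} (h₁ : killing (c 0) (c 1) = (z : ℂ).re)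
    (h₂ : killing (c 0) (c 2) = (w : ℂ).re)
    (h₃ : killing (c 1) (c 2) = (z : ℂ).re * (w : ℂ).re + (z : ℂ).im * (w : ℂ).im) :
    normalSq u c = (Real.sin u.1 * (z : ℂ).im + Real.sin u.2 * (w : ℂ).im) ^ 2 ∧
    sinB u c = (Real.sin u.1 * (z : ℂ).im + Real.sin u.2 * (w : ℂ).im) /
      |Real.sin u.1 * (z : ℂ).im + Real.sin u.2 * (w : ℂ).im| * (z : ℂ).im ∧
    sinC u c = (Real.sin u.1 * (z : ℂ).im + Real.sin u.2 * (w : ℂ).im) /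
      |Real.sin u.1 * (z : ℂ).im + Real.sin u.2 * (w : ℂ).im| * (w : ℂ).im := by
  have hz := circle_re_im z
  have hw := circle_re_im w
  have hn : normalSq u c = (Real.sin u.1 * (z : ℂ).im + Real.sin u.2 * (w : ℂ).im) ^ 2 := by
    rw [normalSq, h₁, h₂, h₃]
    linear_combination -Real.sin u.1 ^ 2 * hz - Real.sin u.2 ^ 2 * hw
  refine ⟨hn, ?_, ?_⟩
  · rw [sinB, hn, Real.sqrt_sq_eq_abs, h₁, h₂, h₃, div_mul_eq_mul_div]
    congr 1
    linear_combination -Real.sin u.1 * hz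
  · rw [sinC, hn, Real.sqrt_sq_eq_abs, h₁, h₂, h₃, div_mul_eq_mul_div]
    congr 1
    linear_combination -Real.sin u.2 * hw

theorem exp_re (x : ℝ) : (Circle.exp x : ℂ).re = Real.cos x := by
  rw [Circle.coe_exp, Complex.exp_ofReal_mul_I_re]

theorem exp_im (x : ℝ) : (Circle.exp x : ℂ).im = Real.sin x := by
  rw [Circle.coe_exp, Complex.exp_ofReal_mul_I_im]

theorem cls_eq_localAngles {σ : RepSpace} (hσ : coords σ ∈ angleDomain u) :
    cls σ = cls (torusFam (localAngles u (coords σ))) := by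
  obtain ⟨⟨z, w⟩, ht⟩ := exists_cls_eq_torusRep (cls σ)
  obtain ⟨a₁, a₂, a₃⟩ := merInner_torusRep (z, w)
  rw [← ht, merInner_cls] at a₁ a₂ a₃
  obtain ⟨hn, hB, hC⟩ := sin_values u a₁ a₂ a₃
  set n := Real.sin u.1 * (z : ℂ).im + Real.sin u.2 * (w : ℂ).im
  obtain ⟨h0, -, hp₁, hp₂⟩ := hσ
  have hn0 : n ≠ 0 := by
    intro h
    rw [Set.mem_ofPred_eq, hn, h] at h0
    norm_num at h0
  have hε : (n / |n|) ^ 2 = 1 := by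
    rw [div_pow, sq_abs, div_self (pow_ne_zero 2 hn0)]
  have hz := circle_re_im z
  have hw := circle_re_im w
  obtain ⟨c₁, s₁⟩ := cos_sin_add_arcsin (x := u.1) (c := killing (coords σ 0) (coords σ 1))
    (s := sinB u (coords σ)) (by
      rw [hB, a₁]
      change (z : ℂ).re ^ 2 + _ = 1
      linear_combination hz + (z : ℂ).im ^ 2 * hε) hp₁
  obtain ⟨c₂, s₂⟩ := cos_sin_add_arcsin (x := u.2) (c := killing (coords σ 0) (coords σ 2))
    (s := sinC u (coords σ)) (by
      rw [hC, a₂]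
      change (w : ℂ).re ^ 2 + _ = 1
      linear_combination hw + (w : ℂ).im ^ 2 * hε) hp₂
  rw [ht]
  have key : Quotient.mk torusSetoid (z, w) =
      Quotient.mk torusSetoid (expT (localAngles u (coords σ))) := by
    -- The sines are recovered up to the common sign n/|n|, which cancels in their product.
    refine (Quotient.sound (torus_rel_of_invariants ?_ ?_ ?_)).symm
    · exact a₁.symm.trans (c₁.symm.trans (exp_re _).symm)
    · exact a₂.symm.trans (c₂.symm.trans (exp_re _).symm)
    · rw [show ((expT (localAngles u (coords σ))).1 : ℂ).im = sinB u (coords σ) from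
          (exp_im _).trans s₁,
        show ((expT (localAngles u (coords σ))).2 : ℂ).im = sinC u (coords σ) from
          (exp_im _).trans s₂, hB, hC]
      linear_combination -((z : ℂ).im * (w : ℂ).im) * hε
  exact congrArg rhoHat key

theorem coords_torusFam_mem {u : ℝ × ℝ} (hu : ellInv (expT u) ≠ expT u) :
    coords (torusFam u) ∈ angleDomain u ∧ localAngles u (coords (torusFam u)) = u := by
  obtain ⟨a₁, a₂, a₃⟩ := merInner_torusRep (expT u)
  rw [merInner_cls] at a₁ a₂ a₃
  obtain ⟨hn, hB, hC⟩ := sin_values u a₁ a₂ a₃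
  have e₁ : ((expT u).1 : ℂ).re = Real.cos u.1 := exp_re _
  have e₂ : ((expT u).2 : ℂ).re = Real.cos u.2 := exp_re _
  have e₃ : ((expT u).1 : ℂ).im = Real.sin u.1 := exp_im _
  have e₄ : ((expT u).2 : ℂ).im = Real.sin u.2 := exp_im _
  rw [ne_eq, ellInv_eq_iff, e₃, e₄] at hu
  have hpos : 0 < Real.sin u.1 * Real.sin u.1 + Real.sin u.2 * Real.sin u.2 := by
    by_contra h
    apply hu
    constructor <;> nlinarith [mul_self_nonneg (Real.sin u.1), mul_self_nonneg (Real.sin u.2)]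
  rw [e₃, e₄] at hn hB hC
  rw [abs_of_pos hpos, div_self hpos.ne', one_mul] at hB hC
  rw [e₁] at a₁
  rw [e₂] at a₂
  change killing (coords (torusFam u) 0) (coords (torusFam u) 1) = _ at a₁
  change killing (coords (torusFam u) 0) (coords (torusFam u) 2) = _ at a₂
  change sinB u (coords (torusFam u)) = _ at hB
  change sinC u (coords (torusFam u)) = _ at hC
  change normalSq u (coords (torusFam u)) = _ at hn
  have z₁ : Real.sin u.1 * Real.cos u.1 - Real.cos u.1 * Real.sin u.1 = 0 := by ring
  have z₂ : Real.sin u.2 * Real.cos u.2 - Real.cos u.2 * Real.sin u.2 = 0 := by ring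
  have o₁ : Real.cos u.1 * Real.cos u.1 + Real.sin u.1 * Real.sin u.1 = 1 := by
    linear_combination Real.sin_sq_add_cos_sq u.1
  have o₂ : Real.cos u.2 * Real.cos u.2 + Real.sin u.2 * Real.sin u.2 = 1 := by
    linear_combination Real.sin_sq_add_cos_sq u.2
  refine ⟨⟨?_, ?_⟩, ?_⟩
  · rw [Set.mem_ofPred_eq, hn]
    positivity
  · rw [Set.mem_preimage, hB, hC, a₁, a₂, z₁, z₂, o₁, o₂]
    refine ⟨⟨?_, ?_⟩, ?_, ?_⟩ <;> simp
  · rw [localAngles, hB, hC, a₁, a₂, z₁, z₂, Real.arcsin_zero, add_zero, add_zero]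

end Coordinates

theorem continuous_torusFam : Continuous torusFam :=
  continuous_torusRep.comp continuous_expT

/-- One direction restricts along the smooth torus family. The other composes with `localAngles`,
which gives angles for the class of any nearby representation, torus or not. -/
theorem smoothAtRep_torusFam_iff {u : ℝ × ℝ} (hu : ellInv (expT u) ≠ expT u) (f : CharVar → ℝ) :
    SmoothAtRep f (torusFam u) ↔ SmoothAtPillow (f ∘ rhoHat) u := by
  constructor
  · rintro ⟨F, hF, hF'⟩
    refine ⟨fun v => F (coords (torusFam v)), hF.comp (contDiffOn_univ.1 smoothFamilyOn_torusFam),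
      ?_⟩
    exact continuous_torusFam.continuousAt.eventually hF'
  · rintro ⟨G, hG, hG'⟩
    obtain ⟨hmem, hval⟩ := coords_torusFam_mem hu
    have hsm : ContDiffOn ℝ ∞ (fun c => G (localAngles u c)) (angleDomain u) :=
      hG.comp_contDiffOn (contDiffOn_localAngles u)
    obtain ⟨F, hF, hF'⟩ := exists_contDiff_eventuallyEq hsm (isOpen_angleDomain u) hmem
    have hcont : ContinuousAt (localAngles u) (coords (torusFam u)) :=
      (contDiffOn_localAngles u).continuousOn.continuousAt ((isOpen_angleDomain u).mem_nhds hmem)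
    have hG'' : ∀ᶠ c in 𝓝 (coords (torusFam u)),
        (f ∘ rhoHat) (pillowPt (localAngles u c)) = G (localAngles u c) := by
      have ht : Filter.Tendsto (localAngles u) (𝓝 (coords (torusFam u))) (𝓝 u) := by
        have := hcont.tendsto
        rwa [hval] at this
      exact ht.eventually hG'
    have hdom := (isOpen_angleDomain u).mem_nhds hmem
    refine ⟨F, hF, ?_⟩
    filter_upwards [continuous_coords.continuousAt.eventually hF',
      continuous_coords.continuousAt.eventually hG'',
      continuous_coords.continuousAt.eventually hdom] with σ h₁ h₂ h₃
    rw [← h₁, ← h₂, Function.comp_apply, rhoHat_pillowPt, ← cls_eq_localAngles u h₃]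

/-! ## The symplectomorphism and the action -/

theorem isPillowSymplectomorphism : IsPillowSymplectomorphism (-1 / 2) where
  homeo := isHomeomorph_rhoHat
  maps_reg := image_pillowReg
  smooth_iff u hu f := smoothAtRep_torusFam_iff (mk_mem_pillowReg.1 hu) f
  smooth_lift := smoothFamilyOn_torusFam
  differential_mem := velocity_torusFam_mem
  differential_bijective u hu := by
    have e : tangentClass (fun u => torusRep (expT u)) u = differential u :=
      funext fun v => tangentClass_torusFam u v
    rw [e]
    exact ⟨differential_injective u, differential_surjective (mk_mem_pillowReg.1 hu)⟩
  form_eq u _ v w := pulledBackForm_torusFam u v w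

theorem pslPillow_mem_pillowReg (g : PSL2Z) {p : Pillow} (hp : p ∈ pillowReg) :
    pslPillow g p ∈ pillowReg := by
  induction g using QuotientGroup.induction_on with
  | H A =>
    induction p using Quotient.inductionOn with
    | h t =>
      rw [pslPillow_coe, mk_mem_pillowReg, ← slTorus_ellInv]
      intro h
      apply mk_mem_pillowReg.1 hp
      have := congrArg (slTorus A⁻¹) h
      rwa [← slTorus_mul, ← slTorus_mul, inv_mul_cancel, slTorus_one, slTorus_one] at this

theorem pslCharVar_image_regSet (g : PSL2Z) : pslCharVar g '' regSet = regSet := by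
  have sub : ∀ g, pslCharVar g '' regSet ⊆ regSet := by
    intro g
    rw [← image_pillowReg]
    rintro _ ⟨_, ⟨p, hp, rfl⟩, rfl⟩
    exact ⟨pslPillow g p, pslPillow_mem_pillowReg g hp, (pslCharVar_rhoHat g p).symm⟩
  refine (sub g).antisymm fun x hx => ?_
  refine ⟨pslCharVar g⁻¹ x, sub g⁻¹ ⟨x, hx, rfl⟩, ?_⟩
  rw [map_inv]
  exact (pslCharVar g).apply_symm_apply x

/-- Each element acts as a word in the half twists, hence as pullback by an automorphism preserving
the pairing. -/
theorem preservesABG_pslCharVar (g : PSL2Z) : PreservesABG (pslCharVar g) := by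
  have hg : pslCharVar g ∈ Subgroup.closure {twistAction₁, twistAction₂} := by
    rw [← range_pslCharVar]
    exact ⟨g, rfl⟩
  obtain ⟨φ, hφ, h⟩ := exists_pullback_of_mem_closure hg
  have hreg := pslCharVar_image_regSet g
  rw [h] at hreg ⊢
  exact preservesABG_pullback hφ hreg

end FourPunctured

end

/-- The half Dehn twists generate a (faithful) action of `PSL(2, ℤ)` on `χ(S², 4)` which preserves
the Atiyah–Bott–Goldman form, and `ρ̂` is equivariant and restricts to a symplectomorphism
`(ℙ*, c dx ∧ dy) → (χ(S², 4)*, ω̂)` for some nonzero constant `c`. -/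
theorem theoremB :
    ∃ Φ : FourPunctured.PSL2Z →*
        (FourPunctured.CharVar ≃ₜ FourPunctured.CharVar),
      Function.Injective Φ ∧
      Φ.range = Subgroup.closure {FourPunctured.twistAction₁, FourPunctured.twistAction₂} ∧
      (∀ g, FourPunctured.PreservesABG (Φ g)) ∧
      (∀ g p, FourPunctured.rhoHat (FourPunctured.pslPillow g p) = Φ g (FourPunctured.rhoHat p)) ∧
      ∃ c : ℝ, c ≠ 0 ∧ FourPunctured.IsPillowSymplectomorphism c :=
  ⟨FourPunctured.pslCharVar, FourPunctured.pslCharVar_injective, FourPunctured.range_pslCharVar,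
    FourPunctured.preservesABG_pslCharVar, fun g p => (FourPunctured.pslCharVar_rhoHat g p).symm,
    -1 / 2, by norm_num, FourPunctured.isPillowSymplectomorphism⟩
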